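/- There is a universal constant $\alpha>0$ such that the following holds. Let $G=(V,E)$ be a finite undirected graph without self-loops (parallel edges are allowed) that has at least three vertices, is 2-connected, and has maximum degree $\Delta$, where parallel edges are counted separately in the degree. Then there is a partition $(A,B)$ of $V$ such that the induced subgraph $G[A]$ is connected, the induced subgraph $G[B]$ is 2-connected, and $$\min\bigl(\mathrm{tw}(G[A]),\,\mathrm{tw}(G[B])\bigr)\;\ge\;\left\lfloor \frac{\alpha\,\mathrm{tw}(G)}{\Delta^2}\right\rfloor .$$ Here $\mathrm{tw}$ denotes treewidth (the least value, over all tree decompositions, of the largest bag size minus one), connected graphs are nonempty, and a graph is called 2-connected if it is connected, has at least two vertices, and has no vertex $u$ such that $G-u$ is disconnected; in particular, a pair of vertices joined by one or more edges is 2-connected. -/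

import Mathlib

universe u v

namespace Graph

/-- A multigraph is connected if it is nonempty and any two of its vertices are joined by a path
(parallel edges play no role here, so this is connectedness of the underlying simple graph). -/
def IsConnected {α : Type u} {β : Type v} (G : Graph α β) : Prop :=
  G.toSimpleGraph.Connected

/-- A multigraph is 2-connected if it is connected, has at least two vertices, and contains no
1-separator, i.e. no vertex `x` such that `G - x` is disconnected. -/
structure IsTwoConnected {α : Type u} {β : Type v} (G : Graph α β) : Prop where
  connected : G.IsConnected
  two_vertices : G.vertexSet.Nontrivial
  no_separator : ∀ x ∈ G.vertexSet, (G.deleteVerts {x}).IsConnected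

/-- The degree of a vertex of a loopless multigraph: the number of incident edges, parallel edges
being counted separately. -/
noncomputable def deg {α : Type u} {β : Type v} (G : Graph α β) (x : α) : ℕ :=
  (G.incidenceSet x).ncard

/-- The maximum degree of a finite multigraph. -/
noncomputable def maxDeg {α : Type u} {β : Type v} (G : Graph α β) : ℕ :=
  sSup (G.deg '' G.vertexSet)

/-- A tree decomposition of `G` over a tree with node set `ι`. -/
structure TreeDecomposition {α : Type u} {β : Type v} (G : Graph α β) (ι : Type) where
  /-- The decomposition tree. -/
  tree : SimpleGraph ι
  isTree : tree.IsTree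
  /-- The bag of a node. -/
  bag : ι → Finset α
  bag_subset : ∀ t, (bag t : Set α) ⊆ G.vertexSet
  vertex_mem : ∀ x ∈ G.vertexSet, ∃ t, x ∈ bag t
  edge_mem : ∀ e x y, G.IsLink e x y → ∃ t, x ∈ bag t ∧ y ∈ bag t
  connected : ∀ x ∈ G.vertexSet, (tree.induce {t | x ∈ bag t}).Connected

/-- The width of a tree decomposition over a finite tree: the largest size of a bag, minus one.
(Truncated subtraction matters only if all bags are empty, i.e. if the graph has no vertex.) -/
def TreeDecomposition.width {α : Type u} {β : Type v} {G : Graph α β} {ι : Type} [Fintype ι]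
    (D : G.TreeDecomposition ι) : ℕ :=
  (Finset.univ.sup fun t => (D.bag t).card) - 1

/-- The treewidth of a finite multigraph: the least width of a tree decomposition. -/
noncomputable def treewidth {α : Type u} {β : Type v} (G : Graph α β) : ℕ :=
  sInf {k | ∃ (n : ℕ) (D : G.TreeDecomposition (Fin n)), D.width = k}

end Graph

/-!
Call a vertex set small if it induces treewidth less than `t`. If `G` contains two disjoint sets
that are not small, then minimal ones are connected and even 2-connected, since decompositions can
be glued along at most one vertex. The component of `A` in `G - B` and its complement then form the
partition.

It remains to see that `tw G < 2 ^ 23 * Δ * t` if of any two disjoint sets one is small. Some bag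
of an optimal decomposition then has a small complement, so few edges cross between the classes of
a partition of `V` into small sets. Choose a deleted set `Z` and a partition of the rest into small
classes with the least value of `8 * Δ * #Z` plus the number of crossing pairs. The edges inside
the classes form a graph of small treewidth, which breaks into light pieces after `O(t)` deletions.
Group the pieces into two sides with many crossing pairs inside each, list the classes of one side
before those of the other, and merge them around the median class into three. One of the sides
falls into a single class, so a constant proportion of the crossing pairs disappears. By minimality
there were only `O(Δ t)` of them, and `Z` has at most a quarter of the size of the largest bag.
Deleting `Z` and the ends of the crossing pairs leaves a small set, which bounds the treewidth.
-/

namespace TreewidthPartition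

open Finset
open scoped Classical

variable {α : Type u} {H K : SimpleGraph α} {b b' t : ℕ} {C S T V X : Finset α}

/-- Two sets of vertices are anticomplete if no edge joins one to the other. -/
def Anticomplete (H : SimpleGraph α) (S T : Finset α) : Prop :=
  ∀ x ∈ S, ∀ y ∈ T, ¬ H.Adj x y

lemma Anticomplete.symm (h : Anticomplete H S T) : Anticomplete H T S :=
  fun x hx y hy hxy => h y hy x hx hxy.symm

lemma Anticomplete.mono {S' T' : Finset α} (h : Anticomplete H S T) (hS : S' ⊆ S) (hT : T' ⊆ T) :
    Anticomplete H S' T' :=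
  fun x hx y hy => h x (hS hx) y (hT hy)

/-- `RootedDecomp H b X C` says that the subgraph of `H` induced by `X ∪ C` has a tree
decomposition with all bags of size at most `b` and with `X` as the bag of the root; `C` is the set
of the remaining vertices. The constructors are a single bag, the identification of the roots of
two decompositions, and the addition of a new root above an old one. -/
inductive RootedDecomp (H : SimpleGraph α) (b : ℕ) : Finset α → Finset α → Prop
  | single (X : Finset α) : #X ≤ b → RootedDecomp H b X ∅
  | union (X C₁ C₂ : Finset α) : RootedDecomp H b X C₁ → RootedDecomp H b X C₂ →
      Disjoint C₁ C₂ → Anticomplete H C₁ C₂ → RootedDecomp H b X (C₁ ∪ C₂)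
  | step (X X' C : Finset α) : #X ≤ b → RootedDecomp H b X' C → Disjoint X C →
      Anticomplete H (X' \ X ∪ C) (X \ X') → RootedDecomp H b X (X' \ X ∪ C)

/-- The subgraph of `H` induced by `S` has treewidth less than `b`, or `S` is empty. -/
def TreewidthLT (H : SimpleGraph α) (b : ℕ) (S : Finset α) : Prop :=
  RootedDecomp H b ∅ S

namespace RootedDecomp

lemma card_le (h : RootedDecomp H b X C) : #X ≤ b := by
  induction h <;> assumption

lemma disjoint (h : RootedDecomp H b X C) : Disjoint X C := by
  induction h with
  | single X _ => exact disjoint_empty_right X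
  | union X C₁ C₂ _ _ _ _ ih₁ ih₂ => exact disjoint_union_right.2 ⟨ih₁, ih₂⟩
  | step X X' C _ _ hd _ _ => exact disjoint_union_right.2 ⟨disjoint_sdiff, hd⟩

lemma inter (h : RootedDecomp H b X C) (S : Finset α) : RootedDecomp H b (X ∩ S) (C ∩ S) := by
  induction h with
  | single X hX =>
    rw [empty_inter]
    exact .single _ ((card_le_card inter_subset_left).trans hX)
  | union X C₁ C₂ _ _ hd hn ih₁ ih₂ =>
    rw [union_inter_distrib_right]
    exact .union _ _ _ ih₁ ih₂ (hd.mono inter_subset_left inter_subset_left)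
      (hn.mono inter_subset_left inter_subset_left)
  | step X X' C hX _ hd hn ih =>
    have e : (X' \ X ∪ C) ∩ S = (X' ∩ S) \ (X ∩ S) ∪ C ∩ S := by grind
    rw [e]
    refine .step _ _ _ ((card_le_card inter_subset_left).trans hX) ih
      (hd.mono inter_subset_left inter_subset_left) (hn.mono ?_ ?_) <;> grind

lemma mono (h : RootedDecomp H b X C) (hb : b ≤ b') : RootedDecomp H b' X C := by
  induction h with
  | single X hX => exact .single _ (hX.trans hb)
  | union X C₁ C₂ _ _ hd hn ih₁ ih₂ => exact .union _ _ _ ih₁ ih₂ hd hn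
  | step X X' C hX _ hd hn ih => exact .step _ _ _ (hX.trans hb) ih hd hn

lemma of_adj_imp (h : RootedDecomp H b X C)
    (hK : ∀ x ∈ X ∪ C, ∀ y ∈ X ∪ C, K.Adj x y → H.Adj x y) : RootedDecomp K b X C := by
  induction h with
  | single X hX => exact .single _ hX
  | union X C₁ C₂ _ _ hd hn ih₁ ih₂ =>
    exact .union _ _ _ (ih₁ (by grind)) (ih₂ (by grind)) hd
      fun x hx y hy hxy => hn x hx y hy (hK x (by grind) y (by grind) hxy)
  | step X X' C hX _ hd hn ih =>
    exact .step _ _ _ hX (ih (by grind)) hd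
      fun x hx y hy hxy => hn x hx y hy (hK x (by grind) y (by grind) hxy)

lemma union_bags (h : RootedDecomp H b X C) {Z : Finset α} (hZ : Disjoint Z C) :
    RootedDecomp H (b + #Z) (X ∪ Z) C := by
  induction h with
  | single X hX => exact .single _ ((card_union_le _ _).trans (by omega))
  | union X C₁ C₂ _ _ hd hn ih₁ ih₂ =>
    rw [disjoint_union_right] at hZ
    exact .union _ _ _ (ih₁ hZ.1) (ih₂ hZ.2) hd hn
  | step X X' C hX _ hd hn ih =>
    rw [disjoint_union_right, disjoint_left] at hZ
    have e : X' \ X ∪ C = (X' ∪ Z) \ (X ∪ Z) ∪ C := by grind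
    rw [e]
    exact .step _ _ _ ((card_union_le _ _).trans (by omega)) (ih hZ.2)
      (disjoint_union_left.2 ⟨hd, hZ.2⟩) (hn.mono e.superset (by grind))

lemma treewidthLT (h : RootedDecomp H b X C) : TreewidthLT H b (X ∪ C) := by
  have := step ∅ X C (by simp) h (by simp) (by simp [Anticomplete])
  rwa [sdiff_empty] at this

end RootedDecomp

namespace TreewidthLT

lemma empty : TreewidthLT H b ∅ := .single _ (by simp)

lemma subset (h : TreewidthLT H b S) (hTS : T ⊆ S) : TreewidthLT H b T := by
  have := RootedDecomp.inter h T
  rwa [empty_inter, inter_eq_right.2 hTS] at this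

lemma mono (h : TreewidthLT H b S) (hb : b ≤ b') : TreewidthLT H b' S :=
  RootedDecomp.mono h hb

lemma of_adj_imp (h : TreewidthLT H b S) (hK : ∀ x ∈ S, ∀ y ∈ S, K.Adj x y → H.Adj x y) :
    TreewidthLT K b S :=
  RootedDecomp.of_adj_imp h (by simpa using hK)

lemma union (hS : TreewidthLT H b S) (hT : TreewidthLT H b T) (hd : Disjoint S T)
    (hn : Anticomplete H S T) : TreewidthLT H b (S ∪ T) :=
  RootedDecomp.union _ _ _ hS hT hd hn

lemma of_card_le (h : #S ≤ b) : TreewidthLT H b S := by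
  simpa using (RootedDecomp.single (H := H) S h).treewidthLT

lemma union_card (h : TreewidthLT H b S) (Z : Finset α) : TreewidthLT H (b + #Z) (S ∪ Z) := by
  have := (RootedDecomp.union_bags (h.subset (sdiff_subset (t := Z))) disjoint_sdiff).treewidthLT
  rwa [empty_union, union_sdiff_self_eq_union, union_comm] at this

lemma of_classes (f : α → ℕ) (hf : ∀ i, TreewidthLT H b {x ∈ S | f x = i})
    (hn : ∀ x ∈ S, ∀ y ∈ S, H.Adj x y → f x = f y) : TreewidthLT H b S := by
  have initial_small : ∀ n, TreewidthLT H b {x ∈ S | f x < n} := by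
    intro n
    induction n with
    | zero => simpa using empty
    | succ n ih =>
      have hdisj : Disjoint {x ∈ S | f x < n} {x ∈ S | f x = n} :=
        disjoint_filter.2 fun x _ hx => hx.ne
      refine (ih.union (hf n) hdisj fun x hx y hy hxy => ?_).subset ?_ <;> grind
  exact (initial_small (S.sup f + 1)).subset fun x hx =>
    mem_filter.2 ⟨hx, Nat.lt_succ_of_le (le_sup (f := f) hx)⟩

end TreewidthLT

/-- The bag of `x` closest to the root can be made the root: a part `C'` of the decomposition that
is already attached to the old root is carried along on the way down. -/
lemma RootedDecomp.exists_reroot {C' : Finset α} (h : RootedDecomp H b X C)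
    (h' : RootedDecomp H b X C') (hd : Disjoint C C') (hn : Anticomplete H C C') {x : α}
    (hx : x ∈ X ∪ C) : ∃ Y, x ∈ Y ∧ RootedDecomp H b Y ((X ∪ C ∪ C') \ Y) := by
  induction h generalizing C' with
  | single X _ =>
    have e : (X ∪ ∅ ∪ C') \ X = C' := by
      rw [union_empty, union_sdiff_cancel_left h'.disjoint]
    exact ⟨X, by simpa using hx, by rwa [e]⟩
  | union X C₁ C₂ h₁ h₂ hd₁₂ hn₁₂ ih₁ ih₂ =>
    rw [disjoint_union_left] at hd
    rw [← union_assoc, mem_union] at hx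
    rcases hx with hx | hx
    · rw [← union_assoc, union_assoc]
      exact ih₁ (.union _ _ _ h₂ h' hd.2 (hn.mono subset_union_right subset_rfl))
        (disjoint_union_right.2 ⟨hd₁₂, hd.1⟩) (by grind [Anticomplete]) hx
    · rw [union_comm C₁, ← union_assoc, union_assoc]
      exact ih₂ (.union _ _ _ h₁ h' hd.1 (hn.mono subset_union_left subset_rfl))
        (disjoint_union_right.2 ⟨hd₁₂.symm, hd.2⟩) (by grind [Anticomplete, Anticomplete.symm])
        (mem_union_right _ hx)
  | step X X' C hX h hdC hnC ih =>
    have hstep := RootedDecomp.step X X' C hX h hdC hnC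
    by_cases hxX : x ∈ X
    · have hall := RootedDecomp.union _ _ _ hstep h' hd hn
      have e : (X ∪ (X' \ X ∪ C) ∪ C') \ X = X' \ X ∪ C ∪ C' := by
        rw [union_assoc, union_sdiff_cancel_left hall.disjoint]
      exact ⟨X, hxX, by rwa [e]⟩
    · have hdX' : Disjoint X' C' := by grind [h'.disjoint, disjoint_left]
      have hup := RootedDecomp.step X' X C' h.card_le h' hdX' (by
        grind [Anticomplete, Anticomplete.symm])
      have e : X ∪ (X' \ X ∪ C) ∪ C' = X' ∪ C ∪ (X \ X' ∪ C') := by grind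
      rw [e]
      exact ih hup (by grind [disjoint_left]) (by grind [Anticomplete, Anticomplete.symm])
        (by grind)

lemma TreewidthLT.rootedDecomp_singleton (h : TreewidthLT H b S) (hb : 1 ≤ b) {x : α}
    (hx : x ∈ S) : RootedDecomp H b {x} (S.erase x) := by
  obtain ⟨Y, hxY, hY⟩ := RootedDecomp.exists_reroot h (.single ∅ (by simp))
    (disjoint_empty_right S) (by simp [Anticomplete]) (by simpa using hx)
  have hroot := RootedDecomp.step {x} _ _ (by simpa using hb) (hY.inter S)
    (by grind [disjoint_left]) (by grind [Anticomplete])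
  convert hroot using 1
  grind

lemma RootedDecomp.treewidthLT_or_exists_compl
    (hV : ∀ A ⊆ V, ∀ B ⊆ V, Disjoint A B → TreewidthLT H t A ∨ TreewidthLT H t B)
    (h : RootedDecomp H b X C) (hC : C ⊆ V) (hN : Anticomplete H C (V \ (X ∪ C))) :
    TreewidthLT H t C ∨ ∃ W : Finset α, #W ≤ b ∧ TreewidthLT H t (V \ W) := by
  induction h with
  | single X _ => exact .inl .empty
  | union X C₁ C₂ _ _ hd hn ih₁ ih₂ =>
    rw [union_subset_iff] at hC
    rcases ih₁ hC.1 (by grind [Anticomplete]) with small₁ | hW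
    · rcases ih₂ hC.2 (by grind [Anticomplete, Anticomplete.symm]) with small₂ | hW
      · exact .inl (small₁.union small₂ hd hn)
      · exact .inr hW
    · exact .inr hW
  | step X X' C _ h _ hn ih =>
    have hN' : Anticomplete H C (V \ (X' ∪ C)) := by grind [Anticomplete]
    rcases ih (subset_union_right.trans hC) hN' with smallC | hW
    · by_cases hnew : TreewidthLT H t (X' \ X ∪ C)
      · exact .inl hnew
      · have hrest := (hV _ hC (V \ (X' \ X ∪ C)) sdiff_subset disjoint_sdiff).resolve_left hnew
        have hout : TreewidthLT H t (V \ (X' ∪ C)) := hrest.subset (by grind)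
        refine .inr ⟨X', h.card_le, (smallC.union hout ?_ hN').subset ?_⟩ <;> grind [disjoint_left]
    · exact .inr hW

/-- Going up from the leaves, take the first bag below which the decomposition is no longer small:
the part outside is then small, and so are the parts below the bag. -/
lemma TreewidthLT.exists_card_le_treewidthLT_sdiff
    (hV : ∀ A ⊆ V, ∀ B ⊆ V, Disjoint A B → TreewidthLT H t A ∨ TreewidthLT H t B)
    (h : TreewidthLT H b V) : ∃ W ⊆ V, #W ≤ b ∧ TreewidthLT H t (V \ W) := by
  rcases RootedDecomp.treewidthLT_or_exists_compl hV h subset_rfl (by simp [Anticomplete]) with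
    hsmall | ⟨W, hWb, hW⟩
  · exact ⟨∅, by simp, by simp, hsmall.subset sdiff_subset⟩
  · exact ⟨V ∩ W, inter_subset_left, (card_le_card inter_subset_right).trans hWb,
      by rwa [sdiff_inter_self_left]⟩

/-- `Shattered H w θ D` says that `D` is a union of classes, each of weight at most `θ`, with no
edges of `H` between different classes. The classes are the fibres of a labelling. -/
def Shattered (H : SimpleGraph α) (w : α → ℕ) (θ : ℕ) (D : Finset α) : Prop :=
  ∃ q : α → ℕ, (∀ x ∈ D, ∀ y ∈ D, H.Adj x y → q x = q y) ∧ ∀ i, ∑ x ∈ D with q x = i, w x ≤ θ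

variable {w : α → ℕ} {θ : ℕ}

namespace Shattered

lemma of_sum_le (h : ∑ x ∈ S, w x ≤ θ) : Shattered H w θ S :=
  ⟨0, fun _ _ _ _ _ => rfl, fun _ => (sum_le_sum_of_subset (filter_subset _ _)).trans h⟩

lemma subset (h : Shattered H w θ S) (hTS : T ⊆ S) : Shattered H w θ T := by
  obtain ⟨q, hq, hw⟩ := h
  exact ⟨q, fun x hx y hy => hq x (hTS hx) y (hTS hy),
    fun i => (sum_le_sum_of_subset (filter_subset_filter _ hTS)).trans (hw i)⟩

lemma union (hS : Shattered H w θ S) (hT : Shattered H w θ T) (hn : Anticomplete H S T) :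
    Shattered H w θ (S ∪ T) := by
  obtain ⟨p, hp, hpw⟩ := hS
  obtain ⟨q, hq, hqw⟩ := hT
  refine ⟨fun x => if x ∈ S then 2 * p x else 2 * q x + 1, ?_, fun i => ?_⟩
  · grind [Anticomplete, SimpleGraph.adj_comm]
  · rcases Nat.even_or_odd' i with ⟨j, rfl | rfl⟩
    · exact (sum_le_sum_of_subset (by grind)).trans (hpw j)
    · exact (sum_le_sum_of_subset (by grind)).trans (hqw j)

end Shattered

/-- The inductive statement behind the breaking lemma, for a decomposition with root bag `X`.
After deleting `Z`, the part `D` of `C` is shattered and detached from everything else, while the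
remainder `R` may still be attached to `X`. The bound on `#Z` charges the weight that has left the
remainder. -/
def Breakable (H : SimpleGraph α) (w : α → ℕ) (θ b : ℕ) (X C : Finset α) : Prop :=
  ∃ Z : Finset α, ∃ R ⊆ C, ∃ D ⊆ C, C ⊆ D ∪ R ∪ Z ∧ Shattered H w θ D ∧
    Anticomplete H D R ∧ Anticomplete H D (X \ Z) ∧
    ∑ x ∈ R, w x ≤ θ ∧ #Z * θ + b * ∑ x ∈ R, w x ≤ b * ∑ x ∈ C, w x

namespace Breakable

lemma union {C₁ C₂ : Finset α} (hX : #X ≤ b) (h₁ : Breakable H w θ b X C₁)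
    (h₂ : Breakable H w θ b X C₂) (hd : Disjoint C₁ C₂) (hn : Anticomplete H C₁ C₂) :
    Breakable H w θ b X (C₁ ∪ C₂) := by
  obtain ⟨Z₁, R₁, hR₁, D₁, hD₁, hcover₁, hshat₁, hDR₁, hDX₁, hR₁θ, hcost₁⟩ := h₁
  obtain ⟨Z₂, R₂, hR₂, D₂, hD₂, hcover₂, hshat₂, hDR₂, hDX₂, hR₂θ, hcost₂⟩ := h₂
  have hCsum : ∑ x ∈ C₁ ∪ C₂, w x = ∑ x ∈ C₁, w x + ∑ x ∈ C₂, w x := sum_union hd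
  have hRsum : ∑ x ∈ R₁ ∪ R₂, w x = ∑ x ∈ R₁, w x + ∑ x ∈ R₂, w x :=
    sum_union (hd.mono hR₁ hR₂)
  have hcard := Nat.mul_le_mul_right θ (card_union_le Z₁ Z₂)
  by_cases hlight : ∑ x ∈ R₁ ∪ R₂, w x ≤ θ
  · refine ⟨Z₁ ∪ Z₂, R₁ ∪ R₂, by grind, D₁ ∪ D₂, by grind, by grind,
      hshat₁.union hshat₂ (hn.mono hD₁ hD₂), by grind [Anticomplete, Anticomplete.symm],
      by grind [Anticomplete], hlight, ?_⟩
    rw [hCsum, hRsum]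
    linarith
  · have hcardX := Nat.mul_le_mul_right θ (card_union_le (Z₁ ∪ Z₂) X)
    have hXθ := Nat.mul_le_mul hX (not_le.1 hlight).le
    refine ⟨Z₁ ∪ Z₂ ∪ X, ∅, by simp, (D₁ ∪ R₁) ∪ (D₂ ∪ R₂), by grind, by grind,
      (hshat₁.union (.of_sum_le hR₁θ) hDR₁).union (hshat₂.union (.of_sum_le hR₂θ) hDR₂)
        (hn.mono (by grind) (by grind)),
      by simp [Anticomplete], by grind [Anticomplete], by simp, ?_⟩
    rw [hCsum, sum_empty]
    rw [hRsum] at hXθ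
    linarith

lemma step {X' : Finset α} (hX' : #X' ≤ b) (h : Breakable H w θ b X' C) (hd : Disjoint X' C)
    (hn : Anticomplete H C (X \ X')) : Breakable H w θ b X (X' \ X ∪ C) := by
  obtain ⟨Z, R, hR, D, hD, hcover, hshat, hDR, hDX, hRθ, hcost⟩ := h
  have hCsum : ∑ x ∈ X' \ X ∪ C, w x = ∑ x ∈ X' \ X, w x + ∑ x ∈ C, w x :=
    sum_union (hd.mono_left sdiff_subset)
  have hRsum : ∑ x ∈ (X' \ X) \ Z ∪ R, w x ≤ ∑ x ∈ X' \ X, w x + ∑ x ∈ R, w x :=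
    (sum_union (hd.mono (sdiff_subset.trans sdiff_subset) hR)).trans_le
      (Nat.add_le_add_right (sum_le_sum_of_subset sdiff_subset) _)
  have hbRsum := Nat.mul_le_mul_left b hRsum
  by_cases hlight : ∑ x ∈ (X' \ X) \ Z ∪ R, w x ≤ θ
  · refine ⟨Z, (X' \ X) \ Z ∪ R, by grind, D, by grind, by grind, hshat,
      by grind [Anticomplete], by grind [Anticomplete], hlight, ?_⟩
    rw [hCsum]
    linarith
  · have hcard := Nat.mul_le_mul_right θ (card_union_le Z X')
    have hX'θ := Nat.mul_le_mul hX' (not_le.1 hlight).le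
    refine ⟨Z ∪ X', ∅, by simp, D ∪ R, by grind, by grind,
      hshat.union (.of_sum_le hRθ) hDR, by simp [Anticomplete], by grind [Anticomplete],
      by simp, ?_⟩
    rw [hCsum, sum_empty]
    linarith

end Breakable

lemma RootedDecomp.breakable (h : RootedDecomp H b X C) (w : α → ℕ) (θ : ℕ) :
    Breakable H w θ b X C := by
  induction h with
  | single X _ =>
    exact ⟨∅, ∅, by simp, ∅, by simp, by simp, .of_sum_le (by simp),
      by simp [Anticomplete], by simp [Anticomplete], by simp, by simp⟩
  | union X C₁ C₂ h₁ _ hd hn ih₁ ih₂ => exact ih₁.union h₁.card_le ih₂ hd hn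
  | step X X' C _ h _ hn ih =>
    exact ih.step h.card_le h.disjoint (hn.mono subset_union_right subset_rfl)

lemma TreewidthLT.exists_shattered_sdiff (h : TreewidthLT H b S) (w : α → ℕ) (θ : ℕ) :
    ∃ Z : Finset α, #Z * θ ≤ b * ∑ x ∈ S, w x ∧ Shattered H w θ (S \ Z) := by
  obtain ⟨Z, R, -, D, -, hcover, hshat, hDR, -, hRθ, hcost⟩ := RootedDecomp.breakable h w θ
  exact ⟨Z, le_of_add_le_left hcost,
    (hshat.union (.of_sum_le hRθ) hDR).subset (by grind)⟩

/-- Merge the classes in runs of consecutive labels, starting a new run whenever the weight of all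
earlier classes passes a multiple of `τ`. -/
lemma exists_merge (q : α → ℕ) {τ : ℕ} (hτ : 0 < τ) (hq : ∀ i, ∑ x ∈ S with q x = i, w x ≤ θ) :
    ∃ g : ℕ → ℕ, (∀ i, g i ≤ (∑ x ∈ S, w x) / τ) ∧
      ∀ j, ∑ x ∈ S with g (q x) = j, w x ≤ τ + θ := by
  set before : ℕ → ℕ := fun i => ∑ x ∈ S with q x < i, w x
  refine ⟨fun i => before i / τ,
    fun i => Nat.div_le_div_right (sum_le_sum_of_subset (filter_subset _ _)), fun j => ?_⟩
  set T : Finset α := {x ∈ S | before (q x) / τ = j}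
  rcases T.eq_empty_or_nonempty with hempty | hne
  · simp [hempty]
  obtain ⟨x₀, hx₀, hmin⟩ := T.exists_min_image q hne
  obtain ⟨x₁, hx₁, hmax⟩ := T.exists_max_image q hne
  have hcover : {x ∈ S | q x < q x₀} ∪ T ⊆ {x ∈ S | q x < q x₁} ∪ {x ∈ S | q x = q x₁} := by
    grind
  have hdisj : Disjoint {x ∈ S | q x < q x₀} T := by grind [disjoint_left]
  have hbound : before (q x₀) + ∑ x ∈ T, w x ≤ before (q x₁) + θ :=
    calc before (q x₀) + ∑ x ∈ T, w x
        = ∑ x ∈ {x ∈ S | q x < q x₀} ∪ T, w x := (sum_union hdisj).symm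
      _ ≤ ∑ x ∈ {x ∈ S | q x < q x₁} ∪ {x ∈ S | q x = q x₁}, w x := sum_le_sum_of_subset hcover
      _ = before (q x₁) + ∑ x ∈ S with q x = q x₁, w x := sum_union (by grind [disjoint_left])
      _ ≤ before (q x₁) + θ := Nat.add_le_add_left (hq _) _
  have hquot : before (q x₀) / τ = before (q x₁) / τ :=
    (mem_filter.1 hx₀).2.trans (mem_filter.1 hx₁).2.symm
  have hgap : before (q x₁) < before (q x₀) + τ := by
    calc before (q x₁) < τ * (before (q x₁) / τ + 1) := Nat.lt_mul_div_succ _ hτ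
      _ = τ * (before (q x₀) / τ) + τ := by rw [← hquot]; ring
      _ ≤ before (q x₀) + τ := Nat.add_le_add_right (Nat.mul_div_le _ _) _
  omega

lemma sum_card_incident (E : Finset (α × α)) (T : Finset α) :
    ∑ x ∈ T, (#{p ∈ E | p.1 = x} + #{p ∈ E | p.2 = x}) =
      #{p ∈ E | p.1 ∈ T} + #{p ∈ E | p.2 ∈ T} := by
  rw [sum_add_distrib]
  congr 1
  · exact sum_card_fiberwise_eq_card_filter E T Prod.fst
  · exact sum_card_fiberwise_eq_card_filter E T Prod.snd

lemma exists_card_le_mul_card_fiber_prod (E : Finset (α × α)) (r : α → ℕ) {n : ℕ}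
    (hr : ∀ x, r x < n) : ∃ i j, #E ≤ n ^ 2 * #{p ∈ E | r p.1 = i ∧ r p.2 = j} := by
  rcases E.eq_empty_or_nonempty with rfl | ⟨p, -⟩
  · exact ⟨0, 0, by simp⟩
  have hne : (range n ×ˢ range n).Nonempty := ⟨(r p.1, r p.2), by simp [hr]⟩
  have hcount : #E = ∑ c ∈ range n ×ˢ range n, #{p ∈ E | (r p.1, r p.2) = c} :=
    card_eq_sum_card_fiberwise fun p _ => by simp [hr]
  obtain ⟨c, -, hc⟩ := exists_le_of_sum_le (f := fun _ => #E)
    (g := fun c => n ^ 2 * #{p ∈ E | (r p.1, r p.2) = c}) hne (by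
      rw [← mul_sum, ← hcount]; simp [sq])
  exact ⟨c.1, c.2, by simpa only [Prod.ext_iff] using hc⟩

/-- Take the two labels between which most pairs run; few pairs meet either of them. -/
lemma exists_balanced_union (E : Finset (α × α)) (r : α → ℕ) {n ℓ : ℕ} (hr : ∀ x, r x < n)
    (hℓ : ∀ i, #{p ∈ E | r p.1 = i} + #{p ∈ E | r p.2 = i} ≤ ℓ) :
    ∃ P : ℕ → Prop, #E ≤ n ^ 2 * #{p ∈ E | P (r p.1) ∧ P (r p.2)} ∧
      #E ≤ #{p ∈ E | ¬ P (r p.1) ∧ ¬ P (r p.2)} + 2 * ℓ := by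
  obtain ⟨i, j, hij⟩ := exists_card_le_mul_card_fiber_prod E r hr
  refine ⟨fun k => k = i ∨ k = j, hij.trans (Nat.mul_le_mul_left _ (card_le_card ?_)), ?_⟩
  · grind
  · have hcover : E ⊆ {p ∈ E | ¬ (r p.1 = i ∨ r p.1 = j) ∧ ¬ (r p.2 = i ∨ r p.2 = j)} ∪
        (({p ∈ E | r p.1 = i} ∪ {p ∈ E | r p.2 = i}) ∪
          ({p ∈ E | r p.1 = j} ∪ {p ∈ E | r p.2 = j})) := by grind
    calc #E ≤ _ := card_le_card hcover
      _ ≤ _ := card_union_le _ _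
      _ ≤ _ := Nat.add_le_add_left (card_union_le _ _) _
      _ ≤ _ := Nat.add_le_add_left (Nat.add_le_add ((card_union_le _ _).trans (hℓ i))
          ((card_union_le _ _).trans (hℓ j))) _
      _ = _ := by simp only [two_mul]

/-- The ordered pairs of adjacent vertices of `S` that lie in different classes of the partition
of `S` into the fibres of `f`; each crossing edge is counted twice. -/
noncomputable def crossPairs (H : SimpleGraph α) (S : Finset α) (f : α → ℕ) : Finset (α × α) :=
  {p ∈ S ×ˢ S | H.Adj p.1 p.2 ∧ f p.1 ≠ f p.2}

/-- The subgraph of `H` formed by the edges inside the fibres of `f`. -/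
def withinClasses (H : SimpleGraph α) (f : α → ℕ) : SimpleGraph α where
  Adj x y := H.Adj x y ∧ f x = f y
  symm := ⟨fun _ _ h => ⟨h.1.symm, h.2.symm⟩⟩
  loopless := ⟨fun x h => H.loopless.irrefl x h.1⟩

variable {f : α → ℕ}

lemma mem_crossPairs {p : α × α} :
    p ∈ crossPairs H S f ↔ (p.1 ∈ S ∧ p.2 ∈ S) ∧ H.Adj p.1 p.2 ∧ f p.1 ≠ f p.2 := by
  simp [crossPairs]

lemma crossPairs_subset (hTS : T ⊆ S) : crossPairs H T f ⊆ crossPairs H S f :=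
  filter_subset_filter _ (product_subset_product hTS hTS)

lemma treewidthLT_withinClasses (hf : ∀ i, TreewidthLT H t {x ∈ S | f x = i}) :
    TreewidthLT (withinClasses H f) t S :=
  .of_classes f (fun i => (hf i).of_adj_imp fun _ _ _ _ h => h.1) fun _ _ _ _ h => h.2

/-- Either many crossing pairs disappear when `Z` is deleted, or the within-class edges can be cut
by `U` into two sides with many crossing pairs inside each of them. -/
lemma exists_card_crossPairs_sdiff (hf : ∀ i, TreewidthLT H t {x ∈ S | f x = i})
    (hM : 16 ≤ #(crossPairs H S f)) :
    ∃ Z : Finset α, #Z ≤ 64 * t ∧ (2 * #(crossPairs H (S \ Z) f) ≤ #(crossPairs H S f) ∨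
      ∃ U : α → Prop, (∀ x ∈ S \ Z, ∀ y ∈ S \ Z, H.Adj x y → f x = f y → (U x ↔ U y)) ∧
        #(crossPairs H S f) ≤ 8192 * #{p ∈ crossPairs H (S \ Z) f | U p.1 ∧ U p.2} ∧
        #(crossPairs H S f) ≤ 8192 * #{p ∈ crossPairs H (S \ Z) f | ¬ U p.1 ∧ ¬ U p.2}) := by
  set E := crossPairs H S f
  set w : α → ℕ := fun x => #{p ∈ E | p.1 = x} + #{p ∈ E | p.2 = x}
  have hwS : ∑ x ∈ S, w x ≤ 2 * #E := by
    rw [sum_card_incident, two_mul]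
    exact Nat.add_le_add (card_filter_le _ _) (card_filter_le _ _)
  set θ := #E / 16
  obtain ⟨Z, hZ, q, hq, hqw⟩ := (treewidthLT_withinClasses hf).exists_shattered_sdiff w θ
  refine ⟨Z, ?_, ?_⟩
  · have hcharge := hZ.trans (Nat.mul_le_mul_left t hwS)
    exact Nat.le_of_mul_le_mul_right (c := θ) (by nlinarith [show #E ≤ 32 * θ by omega])
      (by omega)
  rw [or_iff_not_imp_left, not_le]
  intro hmany
  obtain ⟨g, hg, hgw⟩ := exists_merge q (by omega : 0 < θ) hqw
  have hg64 (x : α) : g (q x) < 64 := by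
    have hwSZ := (sum_le_sum_of_subset (f := w) (sdiff_subset (s := S) (t := Z))).trans hwS
    exact (hg _).trans_lt (Nat.div_lt_of_lt_mul (by omega))
  have hincident (i : ℕ) : #{p ∈ crossPairs H (S \ Z) f | g (q p.1) = i} +
      #{p ∈ crossPairs H (S \ Z) f | g (q p.2) = i} ≤ θ + θ := by
    refine le_trans ?_ (hgw i)
    rw [sum_card_incident]
    refine Nat.add_le_add (card_le_card fun p hp => ?_) (card_le_card fun p hp => ?_) <;>
      grind [mem_crossPairs]
  obtain ⟨P, hin, hout⟩ := exists_balanced_union _ (fun x => g (q x)) hg64 hincident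
  refine ⟨fun x => P (g (q x)), ?_⟩
  beta_reduce
  exact ⟨fun x hx y hy hxy hfxy => by rw [hq x hx y hy ⟨hxy, hfxy⟩], by omega, by omega⟩

lemma exists_median
    (hV : ∀ A ⊆ V, ∀ B ⊆ V, Disjoint A B → TreewidthLT H t A ∨ TreewidthLT H t B)
    (hS : S ⊆ V) (h : α → ℕ) :
    ∃ m, TreewidthLT H t {x ∈ S | h x < m} ∧ TreewidthLT H t {x ∈ S | m < h x} := by
  by_cases hlarge : ∃ n, ¬ TreewidthLT H t {x ∈ S | h x < n}
  · obtain ⟨m, hm⟩ : ∃ m, Nat.find hlarge = m + 1 :=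
      Nat.exists_eq_succ_of_ne_zero fun h0 => Nat.find_spec hlarge (by simpa [h0] using .empty)
    refine ⟨m, not_not.1 (Nat.find_min hlarge (by omega)),
      (hV {x ∈ S | h x < m + 1} ?_ _ ?_ ?_).resolve_left (hm ▸ Nat.find_spec hlarge)⟩ <;>
      grind [disjoint_left]
  · push Not at hlarge
    refine ⟨S.sup h, hlarge _, TreewidthLT.empty.subset fun x hx => ?_⟩
    exact absurd (le_sup (f := h) (mem_filter.1 hx).1) (not_le.2 (mem_filter.1 hx).2)

/-- List the classes of `f` inside `U` first, then those outside, and keep only three classes: the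
median class, the union of the classes before it and the union of the classes after it. -/
lemma exists_coarsening
    (hV : ∀ A ⊆ V, ∀ B ⊆ V, Disjoint A B → TreewidthLT H t A ∨ TreewidthLT H t B)
    (hS : S ⊆ V) (hf : ∀ i, TreewidthLT H t {x ∈ S | f x = i}) {U : α → Prop}
    (hU : ∀ x ∈ S, ∀ y ∈ S, H.Adj x y → f x = f y → (U x ↔ U y)) :
    ∃ f' : α → ℕ, (∀ i, TreewidthLT H t {x ∈ S | f' x = i}) ∧
      crossPairs H S f' ⊆ crossPairs H S f ∧
      ∃ c, (∀ x ∈ S, U x → f' x = c) ∨ ∀ x ∈ S, ¬ U x → f' x = c := by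
  set N := S.sup f + 1
  have hfN : ∀ x ∈ S, f x < N := fun x hx => Nat.lt_succ_of_le (le_sup (f := f) hx)
  set h : α → ℕ := fun x => if U x then f x else N + f x
  obtain ⟨m, hbefore, hafter⟩ := exists_median hV hS h
  have hmedian : TreewidthLT H t {x ∈ S | h x = m} :=
    (hf (if m < N then m else m - N)).subset (by grind)
  refine ⟨fun x => if h x < m then 0 else if h x = m then 1 else 2, fun i => ?_, ?_, ?_⟩
  · obtain rfl | rfl | hi : i = 0 ∨ i = 1 ∨ 2 ≤ i := by omega
    · exact hbefore.subset (by grind)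
    · exact hmedian.subset (by grind)
    · exact hafter.subset (by grind)
  · intro p hp
    have hhp : f p.1 = f p.2 → h p.1 = h p.2 := by grind [mem_crossPairs]
    grind [mem_crossPairs]
  · by_cases hmN : m < N
    · exact ⟨2, .inr (by grind)⟩
    · exact ⟨0, .inl (by grind)⟩

lemma exists_card_crossPairs_le
    (hV : ∀ A ⊆ V, ∀ B ⊆ V, Disjoint A B → TreewidthLT H t A ∨ TreewidthLT H t B)
    (hS : S ⊆ V) (hf : ∀ i, TreewidthLT H t {x ∈ S | f x = i})
    (hM : 16 ≤ #(crossPairs H S f)) :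
    ∃ (Z : Finset α) (f' : α → ℕ), (∀ i, TreewidthLT H t {x ∈ S \ Z | f' x = i}) ∧
      #Z ≤ 64 * t ∧ 8192 * #(crossPairs H (S \ Z) f') ≤ 8191 * #(crossPairs H S f) := by
  have hfsdiff (Z : Finset α) (i : ℕ) : TreewidthLT H t {x ∈ S \ Z | f x = i} :=
    (hf i).subset (filter_subset_filter _ sdiff_subset)
  obtain ⟨Z, hZ, hfew | ⟨U, hU, hin, hout⟩⟩ := exists_card_crossPairs_sdiff hf hM
  · exact ⟨Z, f, hfsdiff Z, hZ, by omega⟩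
  obtain ⟨f', hf', hsub, c, hc⟩ := exists_coarsening hV (sdiff_subset.trans hS) (hfsdiff Z) hU
  refine ⟨Z, f', hf', hZ, ?_⟩
  have hle := card_le_card (crossPairs_subset (H := H) (f := f) (sdiff_subset (s := S) (t := Z)))
  have removed (D : Finset (α × α)) (hD : D ⊆ crossPairs H (S \ Z) f)
      (hmono : ∀ p ∈ D, f' p.1 = f' p.2) (hcard : #(crossPairs H S f) ≤ 8192 * #D) :
      8192 * #(crossPairs H (S \ Z) f') ≤ 8191 * #(crossPairs H S f) := by
    have hrest : crossPairs H (S \ Z) f' ⊆ crossPairs H (S \ Z) f \ D := by grind [mem_crossPairs]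
    have := card_le_card hrest
    rw [card_sdiff_of_subset hD] at this
    omega
  rcases hc with hc | hc
  · exact removed _ (filter_subset _ _) (by grind [mem_crossPairs]) hin
  · exact removed _ (filter_subset _ _) (by grind [mem_crossPairs]) hout

lemma card_crossPairs_incident_le (x : α) :
    #{p ∈ crossPairs H V f | p.1 = x} + #{p ∈ crossPairs H V f | p.2 = x} ≤
      2 * #{y ∈ V | H.Adj x y} := by
  rw [two_mul]
  refine Nat.add_le_add (card_le_card_of_injOn Prod.snd ?_ ?_)
    (card_le_card_of_injOn Prod.fst ?_ ?_)
  · grind [Set.MapsTo, mem_crossPairs]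
  · grind [Set.InjOn]
  · grind [Set.MapsTo, mem_crossPairs, SimpleGraph.adj_comm]
  · grind [Set.InjOn]

lemma exists_classes_card_crossPairs_le {Δ : ℕ} (ht : 1 ≤ t)
    (hdeg : ∀ x ∈ V, #{y ∈ V | H.Adj x y} ≤ Δ) {W : Finset α} (hWV : W ⊆ V)
    (hW : TreewidthLT H t (V \ W)) :
    ∃ f : α → ℕ, (∀ i, TreewidthLT H t {x ∈ V | f x = i}) ∧
      #(crossPairs H V f) ≤ #W * (2 * Δ) := by
  obtain ⟨g, hg⟩ := Set.countable_iff_exists_injOn.1 W.countable_toSet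
  set f : α → ℕ := fun x => if x ∈ W then g x + 1 else 0
  refine ⟨f, ?_, ?_⟩
  · rintro (_ | i)
    · exact hW.subset (by grind)
    · exact .of_card_le (le_trans (card_le_one.2 (by grind [Set.InjOn])) ht)
  · have hcover : crossPairs H V f ⊆
        {p ∈ crossPairs H V f | p.1 ∈ W} ∪ {p ∈ crossPairs H V f | p.2 ∈ W} := by
      grind [mem_crossPairs]
    calc #(crossPairs H V f) ≤ _ := (card_le_card hcover).trans (card_union_le _ _)
      _ = ∑ x ∈ W, (#{p ∈ crossPairs H V f | p.1 = x} + #{p ∈ crossPairs H V f | p.2 = x}) :=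
          (sum_card_incident _ W).symm
      _ ≤ #W * (2 * Δ) := sum_le_card_nsmul _ _ _ fun x hx =>
          (card_crossPairs_incident_le x).trans (Nat.mul_le_mul_left 2 (hdeg x (hWV hx)))

lemma treewidthLT_add_card_crossPairs {Z : Finset α}
    (hf : ∀ i, TreewidthLT H t {x ∈ V \ Z | f x = i}) :
    TreewidthLT H (t + (#Z + #(crossPairs H (V \ Z) f))) V := by
  set Q := (crossPairs H (V \ Z) f).image Prod.fst
  have huncrossed : TreewidthLT H t ((V \ Z) \ Q) := by
    refine .of_classes f (fun i => (hf i).subset (filter_subset_filter _ sdiff_subset)) ?_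
    intro x hx y hy hxy
    by_contra hfxy
    refine (mem_sdiff.1 hx).2 (mem_image.2 ⟨(x, y), mem_crossPairs.2 ⟨?_, hxy, hfxy⟩, rfl⟩)
    exact ⟨(mem_sdiff.1 hx).1, (mem_sdiff.1 hy).1⟩
  refine ((huncrossed.union_card (Z ∪ Q)).subset (by grind)).mono ?_
  exact Nat.add_le_add_left ((card_union_le _ _).trans (Nat.add_le_add_left card_image_le _)) _

/-- Among all deleted sets `Z` and partitions of the rest into small classes, minimise
`8 * Δ * #Z` plus the number of crossing pairs. -/
lemma exists_classes_sdiff_card_crossPairs_le {Δ : ℕ} (hΔ : 1 ≤ Δ) (ht : 1 ≤ t)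
    (hdeg : ∀ x ∈ V, #{y ∈ V | H.Adj x y} ≤ Δ)
    (hV : ∀ A ⊆ V, ∀ B ⊆ V, Disjoint A B → TreewidthLT H t A ∨ TreewidthLT H t B)
    (hb : TreewidthLT H b V) :
    ∃ (Z : Finset α) (f : α → ℕ), (∀ i, TreewidthLT H t {x ∈ V \ Z | f x = i}) ∧
      4 * #Z ≤ b ∧ #(crossPairs H (V \ Z) f) ≤ 2 ^ 22 * (Δ * t) := by
  obtain ⟨W, hWV, hWb, hW⟩ := hb.exists_card_le_treewidthLT_sdiff hV
  obtain ⟨f₀, hf₀, hcross₀⟩ := exists_classes_card_crossPairs_le ht hdeg hWV hW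
  obtain ⟨⟨Z, f⟩, hf, hmin⟩ := exists_minimalFor_of_wellFoundedLT
    (fun s : Finset α × (α → ℕ) => ∀ i, TreewidthLT H t {x ∈ V \ s.1 | s.2 x = i})
    (fun s => 8 * Δ * #s.1 + #(crossPairs H (V \ s.1) s.2)) ⟨(∅, f₀), by simpa⟩
  dsimp only at hf
  replace hmin (Z' : Finset α) (f' : α → ℕ)
      (hf' : ∀ i, TreewidthLT H t {x ∈ V \ Z' | f' x = i}) :
      8 * Δ * #Z + #(crossPairs H (V \ Z) f) ≤ 8 * Δ * #Z' + #(crossPairs H (V \ Z') f') :=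
    (le_total _ _).elim id fun h => hmin (j := (Z', f')) hf' h
  have hpotential : 8 * Δ * #Z + #(crossPairs H (V \ Z) f) ≤ b * (2 * Δ) := by
    have := hmin ∅ f₀ (by simpa)
    rw [card_empty, mul_zero, zero_add, sdiff_empty] at this
    exact this.trans (hcross₀.trans (Nat.mul_le_mul_right _ hWb))
  refine ⟨Z, f, hf, Nat.le_of_mul_le_mul_left (c := 2 * Δ) (by linarith) (by omega), ?_⟩
  by_cases hfew : #(crossPairs H (V \ Z) f) < 16
  · linarith [Nat.mul_pos hΔ ht]
  obtain ⟨Z₁, f', hf', hcard, hcross'⟩ :=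
    exists_card_crossPairs_le hV sdiff_subset hf (not_lt.1 hfew)
  rw [sdiff_sdiff_left, sup_eq_union] at hf' hcross'
  have hstep := hmin (Z ∪ Z₁) f' hf'
  have hcost : 8 * Δ * #(Z ∪ Z₁) ≤ 8 * Δ * #Z + 8 * Δ * (64 * t) := by
    rw [← mul_add]
    exact Nat.mul_le_mul_left _ ((card_union_le _ _).trans (Nat.add_le_add_left hcard _))
  linarith

theorem treewidthLT_of_forall_disjoint {Δ : ℕ} (hΔ : 1 ≤ Δ) (ht : 1 ≤ t)
    (hdeg : ∀ x ∈ V, #{y ∈ V | H.Adj x y} ≤ Δ)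
    (hV : ∀ A ⊆ V, ∀ B ⊆ V, Disjoint A B → TreewidthLT H t A ∨ TreewidthLT H t B) :
    TreewidthLT H (2 ^ 23 * Δ * t) V := by
  obtain ⟨b, hb, hbmin⟩ := exists_minimal_of_wellFoundedLT (TreewidthLT H · V)
    ⟨#V, .of_card_le le_rfl⟩
  obtain ⟨Z, f, hf, hZ, hcross⟩ := exists_classes_sdiff_card_crossPairs_le hΔ ht hdeg hV hb
  have hbound : b ≤ t + (#Z + #(crossPairs H (V \ Z) f)) :=
    (le_total _ _).elim id (hbmin (treewidthLT_add_card_crossPairs hf))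
  exact hb.mono (by linarith [Nat.mul_le_mul_right t hΔ])

section Connectivity

variable {A B P S T U V : Set α}

lemma connected_induce_iff_forall_closed :
    (H.induce S).Connected ↔ S.Nonempty ∧
      ∀ U ⊆ S, U.Nonempty → (∀ x ∈ U, ∀ y ∈ S, H.Adj x y → y ∈ U) → S ⊆ U := by
  constructor
  · intro h
    obtain ⟨x, hx⟩ := h.nonempty
    refine ⟨⟨x, hx⟩, fun U hUS ⟨u, hu⟩ hU y hy => ?_⟩
    by_contra hyU
    obtain ⟨p⟩ := h.preconnected ⟨u, hUS hu⟩ ⟨y, hy⟩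
    obtain ⟨d, -, hfst, hsnd⟩ := p.exists_boundary_dart {z | (z : α) ∈ U} hu hyU
    exact hsnd (hU _ hfst _ d.snd.2 d.adj)
  · rintro ⟨⟨x₀, hx₀⟩, h⟩
    have : Nonempty S := ⟨⟨x₀, hx₀⟩⟩
    refine ⟨fun x y => ?_⟩
    have hreach := h {z | ∃ hz, (H.induce S).Reachable x ⟨z, hz⟩} (fun z hz => hz.1)
      ⟨x, x.2, .rfl⟩ fun a ⟨ha, hxa⟩ b hb hab =>
        ⟨hb, hxa.trans (SimpleGraph.Adj.reachable (SimpleGraph.induce_adj.2 hab))⟩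
    exact (hreach y.2).2

lemma subset_of_connected_induce (hT : (H.induce T).Connected) (hTS : T ⊆ S)
    (hU : ∀ x ∈ U, ∀ y ∈ S, H.Adj x y → y ∈ U) (hTU : (T ∩ U).Nonempty) : T ⊆ U :=
  ((connected_induce_iff_forall_closed.1 hT).2 (T ∩ U) Set.inter_subset_left hTU
    fun x hx y hy hxy => ⟨hy, hU x hx.2 y (hTS hy) hxy⟩).trans Set.inter_subset_right

/-- If `S` were disconnected, then `T` would lie on one side, and the other side would contradict
the hypothesis. -/
lemma connected_induce_of_closed_inter_nonempty (hT : (H.induce T).Connected) (hTS : T ⊆ S)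
    (h : ∀ U ⊆ S, U.Nonempty → (∀ x ∈ U, ∀ y ∈ S, H.Adj x y → y ∈ U) → (T ∩ U).Nonempty) :
    (H.induce S).Connected := by
  refine connected_induce_iff_forall_closed.2
    ⟨(connected_induce_iff_forall_closed.1 hT).1.mono hTS, fun U hUS hUne hU => ?_⟩
  have hTU := subset_of_connected_induce hT hTS hU (h U hUS hUne hU)
  rw [← Set.sdiff_eq_empty, ← Set.not_nonempty_iff_eq_empty]
  intro hne
  obtain ⟨x, hxT, hx⟩ := h (S \ U) Set.sdiff_subset hne fun x hx y hy hxy =>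
    ⟨hy, fun hyU => hx.2 (hU y hyU x hx.1 hxy.symm)⟩
  exact hx.2 (hTU hxT)

lemma connected_induce_sdiff_of_pendant (hS : (H.induce S).Connected) (hne : (S \ P).Nonempty)
    {r : α} (hP : ∀ x ∈ S \ P, ∀ y ∈ S ∩ P, H.Adj x y → x = r) :
    (H.induce (S \ P)).Connected := by
  have hclosed : ∀ U ⊆ S \ P, U.Nonempty → (∀ x ∈ U, ∀ y ∈ S \ P, H.Adj x y → y ∈ U) →
      r ∉ U → S ⊆ U := fun U hUS hUne hU hrU =>
    (connected_induce_iff_forall_closed.1 hS).2 U (hUS.trans Set.sdiff_subset) hUne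
      fun x hx y hy hxy => hU x hx y
        ⟨hy, fun hyP => hrU (hP x (hUS hx) y ⟨hy, hyP⟩ hxy ▸ hx)⟩ hxy
  by_cases hr : r ∈ S \ P
  · refine connected_induce_of_closed_inter_nonempty (T := {r}) (by simp)
      (Set.singleton_subset_iff.2 hr) fun U hUS hUne hU => ⟨r, rfl, ?_⟩
    by_contra hrU
    exact hrU (hclosed U hUS hUne hU hrU hr.1)
  · have hSP := hclosed _ subset_rfl hne (fun x _ y hy _ => hy) hr
    rwa [Set.sdiff_subset.antisymm hSP]

lemma exists_component (hA : (H.induce A).Connected) (hAS : A ⊆ S) :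
    ∃ C, A ⊆ C ∧ C ⊆ S ∧ (H.induce C).Connected ∧ ∀ x ∈ C, ∀ y ∈ S, H.Adj x y → y ∈ C := by
  obtain ⟨a, ha⟩ := (connected_induce_iff_forall_closed.1 hA).1
  set C : Set α := ⋂₀ {U | U ⊆ S ∧ a ∈ U ∧ ∀ x ∈ U, ∀ y ∈ S, H.Adj x y → y ∈ U}
  have hCS : C ⊆ S := Set.sInter_subset_of_mem ⟨subset_rfl, hAS ha, fun _ _ y hy _ => hy⟩
  have haC : a ∈ C := Set.mem_sInter.2 fun U hU => hU.2.1
  have hclosed : ∀ x ∈ C, ∀ y ∈ S, H.Adj x y → y ∈ C := fun x hx y hy hxy =>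
    Set.mem_sInter.2 fun U hU => hU.2.2 x (Set.mem_sInter.1 hx U hU) y hy hxy
  refine ⟨C, subset_of_connected_induce hA hAS hclosed ⟨a, ha, haC⟩, hCS, ?_, hclosed⟩
  refine connected_induce_of_closed_inter_nonempty (T := {a}) (by simp)
    (Set.singleton_subset_iff.2 haC) fun U hUC hUne hU => ?_
  by_contra haU
  have hCU : C ⊆ C \ U := Set.sInter_subset_of_mem ⟨Set.sdiff_subset.trans hCS,
    ⟨haC, fun h => haU ⟨a, rfl, h⟩⟩, fun x hx y hy hxy =>
      ⟨hclosed x hx.1 y hy hxy, fun hyU => hx.2 (hU y hyU x hx.1 hxy.symm)⟩⟩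
  obtain ⟨u, hu⟩ := hUne
  exact (hCU (hUC hu)).2 hu

/-- The subgraph of `H` induced by `S` is 2-connected: it is connected, has at least two vertices,
and stays connected when any one vertex is deleted. -/
structure TwoConnected (H : SimpleGraph α) (S : Set α) : Prop where
  nontrivial : S.Nontrivial
  connected : (H.induce S).Connected
  connected_sdiff : ∀ x ∈ S, (H.induce (S \ {x})).Connected

lemma TwoConnected.pair {x y : α} (h : H.Adj x y) : TwoConnected H {x, y} where
  nontrivial := Set.nontrivial_pair h.ne
  connected := SimpleGraph.induce_pair_connected_of_adj h
  connected_sdiff := by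
    rintro z (rfl | rfl)
    · rw [Set.insert_sdiff_self_of_notMem (by simpa using h.ne)]
      simp
    · rw [Set.pair_comm, Set.insert_sdiff_self_of_notMem (by simpa using h.ne')]
      simp

lemma TwoConnected.exists_singleton_pair (hV : TwoConnected H V) (hcard : 3 ≤ V.ncard) :
    ∃ A ⊆ V, ∃ B ⊆ V, Disjoint A B ∧ (H.induce A).Connected ∧ TwoConnected H B := by
  obtain ⟨v, hv⟩ := hV.nontrivial.nonempty
  have : Nontrivial ↑(V \ {v}) := by
    rw [Set.nontrivial_coe_sort]
    refine (Set.one_lt_ncard_iff_nontrivial_and_finite.1 ?_).1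
    rw [Set.ncard_sdiff_singleton_of_mem hv]
    omega
  obtain ⟨x⟩ : Nonempty ↑(V \ {v}) := inferInstance
  obtain ⟨y, hxy⟩ := (hV.connected_sdiff v hv).preconnected.exists_adj_of_nontrivial x
  refine ⟨{v}, by simpa, {↑x, ↑y}, Set.pair_subset x.2.1 y.2.1, ?_, by simp,
    .pair (SimpleGraph.induce_adj.1 hxy)⟩
  exact Set.disjoint_singleton_left.2 fun h => h.elim (Ne.symm x.2.2) (Ne.symm y.2.2)

/-- A set closed under adjacency in `(V \ A) \ P` and missing `B` would be closed in `V \ P`, as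
edges leaving `A` end in `B`. -/
lemma connected_induce_sdiff_sdiff (hV : (H.induce (V \ P)).Connected)
    (hB : (H.induce (B \ P)).Connected) (hBV : B ⊆ V) (hAV : A ⊆ V) (hAne : A.Nonempty)
    (hAP : Disjoint A P) (hAB : Disjoint A B) (hA : ∀ x ∈ A, ∀ y ∈ V \ B, H.Adj x y → y ∈ A) :
    (H.induce ((V \ A) \ P)).Connected := by
  refine connected_induce_of_closed_inter_nonempty hB
    (Set.sdiff_subset_sdiff_left (Set.subset_sdiff.2 ⟨hBV, hAB.symm⟩)) fun U hUS hUne hU => ?_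
  by_contra hBU
  have hVU : V \ P ⊆ U := by
    refine (connected_induce_iff_forall_closed.1 hV).2 U
      (hUS.trans (Set.sdiff_subset_sdiff_left Set.sdiff_subset)) hUne fun x hx y hy hxy => ?_
    refine hU x hx y ⟨⟨hy.1, fun hyA => (hUS hx).1.2 (hA y hyA x ⟨(hUS hx).1.1, ?_⟩ hxy.symm)⟩,
      hy.2⟩ hxy
    exact fun hxB => hBU ⟨x, ⟨hxB, (hUS hx).2⟩, hx⟩
  obtain ⟨a, ha⟩ := hAne
  exact (hUS (hVU ⟨hAV ha, Set.disjoint_left.1 hAP ha⟩)).1.2 ha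

/-- Take the component of `V \ B` that contains `A` and its complement. -/
theorem TwoConnected.exists_partition (hV : TwoConnected H V) (hA : (H.induce A).Connected)
    (hB : TwoConnected H B) (hAV : A ⊆ V) (hBV : B ⊆ V) (hAB : Disjoint A B) :
    ∃ A' B', A ⊆ A' ∧ B ⊆ B' ∧ A' ∪ B' = V ∧ Disjoint A' B' ∧ (H.induce A').Connected ∧
      TwoConnected H B' := by
  obtain ⟨A', hAA', hA'V, hA', hclosed⟩ := exists_component hA (Set.subset_sdiff.2 ⟨hAV, hAB⟩)
  rw [Set.subset_sdiff] at hA'V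
  have hBB' : B ⊆ V \ A' := Set.subset_sdiff.2 ⟨hBV, hA'V.2.symm⟩
  have hrest {P : Set α} (hVP : (H.induce (V \ P)).Connected)
      (hBP : (H.induce (B \ P)).Connected) (hA'P : Disjoint A' P) :
      (H.induce ((V \ A') \ P)).Connected :=
    connected_induce_sdiff_sdiff hVP hBP hBV hA'V.1
      (connected_induce_iff_forall_closed.1 hA').1 hA'P hA'V.2 hclosed
  refine ⟨A', V \ A', hAA', hBB', Set.union_sdiff_cancel hA'V.1, disjoint_sdiff_self_right, hA',
    hB.nontrivial.mono hBB', ?_, fun x hx => hrest (hV.connected_sdiff x hx.1) ?_ ?_⟩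
  · rw [← Set.sdiff_empty (s := V \ A')]
    exact hrest (by rw [Set.sdiff_empty]; exact hV.connected)
      (by rw [Set.sdiff_empty]; exact hB.connected) (Set.disjoint_empty A')
  · by_cases hxB : x ∈ B
    · exact hB.connected_sdiff x hxB
    · rw [Set.sdiff_singleton_eq_self hxB]
      exact hB.connected
  · exact Set.disjoint_singleton_right.2 hx.2

end Connectivity

section MinimalNotTreewidthLT

lemma exists_anticomplete_of_not_connected_induce (hne : S.Nonempty)
    (h : ¬ (H.induce (S : Set α)).Connected) :
    ∃ U ⊂ S, S \ U ⊂ S ∧ Anticomplete H U (S \ U) := by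
  rw [connected_induce_iff_forall_closed] at h
  push Not at h
  obtain ⟨U, hUS, ⟨u, hu⟩, hU, hSU⟩ := h hne
  obtain ⟨U, rfl⟩ := (S.finite_toSet.subset hUS).exists_finset_coe
  rw [coe_subset] at hUS hSU
  exact ⟨U, ⟨hUS, hSU⟩, sdiff_ssubset hUS ⟨u, hu⟩, by grind [Anticomplete]⟩

lemma connected_induce_of_minimal_not_treewidthLT
    (h : Minimal (fun S => ¬ TreewidthLT H t S) S) : (H.induce (S : Set α)).Connected := by
  by_contra hconn
  have hne : S.Nonempty := nonempty_iff_ne_empty.2 fun hS => h.prop (hS ▸ .empty)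
  obtain ⟨U, hU, hSU, hn⟩ := exists_anticomplete_of_not_connected_induce hne hconn
  have hsmall := (not_not.1 (h.not_prop_of_lt hU)).union (not_not.1 (h.not_prop_of_lt hSU))
    disjoint_sdiff hn
  rw [union_sdiff_of_subset hU.subset] at hsmall
  exact h.prop hsmall

/-- If `x` were a cut vertex, then decompositions of the two sides, re-rooted at the bag `{x}`,
could be glued. -/
lemma twoConnected_of_minimal_not_treewidthLT (ht : 1 ≤ t)
    (h : Minimal (fun S => ¬ TreewidthLT H t S) S) : TwoConnected H (S : Set α) := by
  have hS : S.Nontrivial := by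
    by_contra hS
    rw [← one_lt_card_iff_nontrivial, not_lt] at hS
    exact h.prop (.of_card_le (hS.trans ht))
  refine ⟨hS, connected_induce_of_minimal_not_treewidthLT h, fun x hx => ?_⟩
  have hside : ∀ U ⊂ S.erase x, RootedDecomp H t {x} U := by
    intro U hU
    have hxU : x ∉ U := fun hxU => notMem_erase x S (hU.subset hxU)
    have hlt : insert x U ⊂ S := by grind
    simpa [hxU] using
      (not_not.1 (h.not_prop_of_lt hlt)).rootedDecomp_singleton ht (mem_insert_self x U)
  rw [← coe_erase]
  by_contra hconn
  obtain ⟨U, hU, hSU, hn⟩ := exists_anticomplete_of_not_connected_induce (hS.erase_nonempty) hconn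
  have hglued := (RootedDecomp.union _ _ _ (hside U hU) (hside _ hSU) disjoint_sdiff hn).treewidthLT
  rw [union_sdiff_of_subset hU.subset, ← insert_eq, insert_erase hx] at hglued
  exact h.prop hglued

end MinimalNotTreewidthLT

section TreeDecompositions

variable {ι : Type} {F : SimpleGraph ι} {bag : ι → Finset α} {N P Q : Finset ι} {r s : ι}

/-- `IsTreeDecomp H F bag N` says that the bags of the nodes in `N` form a tree decomposition of the
subgraph of `H` induced by their union. The tree of the decomposition is the subgraph of `F` induced
by `N`, where `F` is meant to be a forest; this is not part of the definition. -/
structure IsTreeDecomp (H : SimpleGraph α) (F : SimpleGraph ι) (bag : ι → Finset α)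
    (N : Finset ι) : Prop where
  connected : (F.induce (N : Set ι)).Connected
  connected_nodes : ∀ x ∈ N.biUnion bag, (F.induce {i | i ∈ N ∧ x ∈ bag i}).Connected
  exists_mem_of_adj : ∀ x ∈ N.biUnion bag, ∀ y ∈ N.biUnion bag, H.Adj x y →
    ∃ i ∈ N, x ∈ bag i ∧ y ∈ bag i

namespace IsTreeDecomp

/-- A vertex occurring on both sides of an edge of the tree occurs at both of its ends, because its
nodes are connected. -/
lemma inter_subset (h : IsTreeDecomp H F bag (P ∪ Q)) (hd : Disjoint P Q)
    (hPQ : ∀ i ∈ P, ∀ j ∈ Q, F.Adj i j → i = r ∧ j = s) :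
    P.biUnion bag ∩ Q.biUnion bag ⊆ bag r ∩ bag s := by
  intro x hx
  simp only [mem_inter, mem_biUnion] at hx ⊢
  obtain ⟨⟨i, hiP, hxi⟩, j, hjQ, hxj⟩ := hx
  have hconn := h.connected_nodes x (mem_biUnion.2 ⟨i, mem_union_left Q hiP, hxi⟩)
  by_contra hrs
  have hPall := (connected_induce_iff_forall_closed.1 hconn).2 {i | i ∈ P ∧ x ∈ bag i}
    (fun k hk => ⟨mem_union_left Q hk.1, hk.2⟩) ⟨i, hiP, hxi⟩ (by
      rintro k ⟨hkP, hxk⟩ l ⟨hl, hxl⟩ hkl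
      refine ⟨(mem_union.1 hl).resolve_right fun hlQ => hrs ?_, hxl⟩
      obtain ⟨rfl, rfl⟩ := hPQ k hkP l hlQ hkl
      exact ⟨hxk, hxl⟩)
  exact disjoint_left.1 hd (hPall (show j ∈ _ from ⟨mem_union_right P hjQ, hxj⟩)).1 hjQ

lemma left (h : IsTreeDecomp H F bag (P ∪ Q)) (hd : Disjoint P Q)
    (hPQ : ∀ i ∈ P, ∀ j ∈ Q, F.Adj i j → i = r ∧ j = s) (hr : r ∈ P) :
    IsTreeDecomp H F bag P where
  connected := by
    have e : (P : Set ι) = ↑(P ∪ Q) \ ↑Q := by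
      rw [← coe_sdiff, union_sdiff_cancel_right hd]
    rw [e]
    refine connected_induce_sdiff_of_pendant h.connected (e ▸ ⟨r, hr⟩) (r := r)
      fun i hi j hj hij => ?_
    exact (hPQ i (by rwa [← e] at hi) j hj.2 hij).1
  connected_nodes x hx := by
    have e : {i | i ∈ P ∧ x ∈ bag i} = {i | i ∈ P ∪ Q ∧ x ∈ bag i} \ ↑Q := by
      ext i
      grind [disjoint_left]
    obtain ⟨i, hiP, hxi⟩ := mem_biUnion.1 hx
    rw [e]
    refine connected_induce_sdiff_of_pendant (h.connected_nodes x (by grind)) (e ▸ ⟨i, hiP, hxi⟩)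
      (r := r) fun i hi j hj hij => ?_
    exact (hPQ i (by rw [← e] at hi; exact hi.1) j hj.2 hij).1
  exists_mem_of_adj x hx y hy hxy := by
    obtain ⟨i, hi, hxi, hyi⟩ := h.exists_mem_of_adj x (by grind) y (by grind) hxy
    rcases mem_union.1 hi with hiP | hiQ
    · exact ⟨i, hiP, hxi, hyi⟩
    · have hroot z (hz : z ∈ P.biUnion bag) (hzi : z ∈ bag i) : z ∈ bag r :=
        (mem_inter.1 (h.inter_subset hd hPQ (mem_inter.2 ⟨hz, mem_biUnion.2 ⟨i, hiQ, hzi⟩⟩))).1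
      exact ⟨r, hr, hroot x hx hxi, hroot y hy hyi⟩

end IsTreeDecomp

lemma exists_split_of_isAcyclic (hF : F.IsAcyclic) (hN : (F.induce (N : Set ι)).Connected)
    (hr : r ∈ N) (hcard : 2 ≤ #N) :
    ∃ P Q s, P ∪ Q = N ∧ Disjoint P Q ∧ r ∈ P ∧ s ∈ Q ∧
      ∀ i ∈ P, ∀ j ∈ Q, F.Adj i j → i = r ∧ j = s := by
  have : Nontrivial ↑(N : Set ι) :=
    Set.nontrivial_coe_sort.2 (one_lt_card_iff_nontrivial.1 hcard)
  obtain ⟨⟨s, hs⟩, hrs⟩ := hN.preconnected.exists_adj_of_nontrivial ⟨r, hr⟩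
  have hbridge := SimpleGraph.isAcyclic_iff_forall_adj_isBridge.1 hF (SimpleGraph.induce_adj.1 hrs)
  rw [SimpleGraph.isBridge_iff] at hbridge
  set Q := {j ∈ N | (F.deleteEdges {s(r, s)}).Reachable s j}
  have hrQ : r ∉ Q := fun h => hbridge (mem_filter.1 h).2.symm
  have hsQ : s ∈ Q := mem_filter.2 ⟨hs, .rfl⟩
  refine ⟨N \ Q, Q, s, sdiff_union_of_subset (filter_subset _ _), sdiff_disjoint,
    mem_sdiff.2 ⟨hr, hrQ⟩, hsQ, fun i hi j hj hij => ?_⟩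
  rw [mem_sdiff] at hi
  have hedge : s(i, j) = s(r, s) := by
    by_contra hne
    refine hi.2 (mem_filter.2 ⟨hi.1, (mem_filter.1 hj).2.trans (SimpleGraph.Adj.reachable ?_)⟩)
    exact (SimpleGraph.deleteEdges_adj.2 ⟨hij, hne⟩).symm
  rcases Sym2.eq_iff.1 hedge with h | ⟨rfl, rfl⟩
  · exact h
  · exact absurd hsQ hi.2

/-- Split the tree at an edge from the root `r` to a neighbour `s`, decompose the two sides with
roots `r` and `s`, put `r` above `s`, and identify the two copies of `r`. -/
lemma IsTreeDecomp.rootedDecomp (hF : F.IsAcyclic) (hb : ∀ i ∈ N, #(bag i) ≤ b)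
    (h : IsTreeDecomp H F bag N) (hr : r ∈ N) :
    RootedDecomp H b (bag r) (N.biUnion bag \ bag r) := by
  induction N using Finset.strongInduction generalizing r with
  | H N ih =>
  by_cases hcard : #N < 2
  · have hN : N = {r} :=
      eq_singleton_iff_unique_mem.2 ⟨hr, fun i hi => card_le_one.1 (by omega) i hi r hr⟩
    simpa [hN] using RootedDecomp.single (H := H) _ (hb r hr)
  obtain ⟨P, Q, s, rfl, hd, hrP, hsQ, hPQ⟩ :=
    exists_split_of_isAcyclic hF h.connected hr (not_lt.1 hcard)
  have hP := ih P (Finset.ssubset_iff_subset_ne.2 ⟨subset_union_left, by grind [disjoint_left]⟩)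
    (fun i hi => hb i (mem_union_left Q hi)) (h.left hd hPQ hrP) hrP
  have hQ := ih Q (Finset.ssubset_iff_subset_ne.2 ⟨subset_union_right, by grind [disjoint_left]⟩)
    (fun i hi => hb i (mem_union_right P hi))
    (IsTreeDecomp.left (by rwa [union_comm]) hd.symm
      (fun i hi j hj hij => (hPQ j hj i hi hij.symm).symm) hsQ) hsQ
  have hcross : ∀ x ∈ P.biUnion bag, x ∈ Q.biUnion bag → x ∈ bag r ∧ x ∈ bag s := fun x hxP hxQ =>
    mem_inter.1 (h.inter_subset hd hPQ (mem_inter.2 ⟨hxP, hxQ⟩))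
  have hadj : ∀ x ∈ (P ∪ Q).biUnion bag, ∀ y ∈ (P ∪ Q).biUnion bag, H.Adj x y →
      (x ∈ P.biUnion bag ∧ y ∈ P.biUnion bag) ∨ x ∈ Q.biUnion bag ∧ y ∈ Q.biUnion bag :=
    fun x hx y hy hxy => by grind [h.exists_mem_of_adj x hx y hy hxy]
  have hrU := subset_biUnion_of_mem bag hrP
  have hsW := subset_biUnion_of_mem bag hsQ
  rw [union_biUnion] at hadj ⊢
  generalize P.biUnion bag = U at *
  generalize Q.biUnion bag = W at *
  clear ih h hPQ
  have hup := RootedDecomp.step (bag r) _ _ (hb r hr) hQ (by grind [disjoint_left])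
    (by grind [Anticomplete])
  have hall := hP.union _ _ _ hup (by grind [disjoint_left]) (by grind [Anticomplete])
  convert hall using 1
  grind

variable {κ : Type} {F' : SimpleGraph κ} {bag' : κ → Finset α} {U W Y : Finset α}

lemma IsTreeDecomp.union [DecidableEq ι] (hP : IsTreeDecomp H F bag P) (hQ : IsTreeDecomp H F bag Q)
    (hr : r ∈ P) (hs : s ∈ Q) (hrs : F.Adj r s)
    (hcross : P.biUnion bag ∩ Q.biUnion bag ⊆ bag r ∩ bag s)
    (hn : Anticomplete H (P.biUnion bag \ Q.biUnion bag) (Q.biUnion bag \ P.biUnion bag)) :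
    IsTreeDecomp H F bag (P ∪ Q) where
  connected := by
    rw [coe_union]
    exact SimpleGraph.connected_induce_union hP.connected.preconnected hQ.connected.preconnected
      hr hs hrs
  connected_nodes x hx := by
    have hnodes : {i | i ∈ P ∪ Q ∧ x ∈ bag i} =
        {i | i ∈ P ∧ x ∈ bag i} ∪ {i | i ∈ Q ∧ x ∈ bag i} := by
      ext i
      simp [or_and_right]
    have hempty {M : Finset ι} (h : x ∉ M.biUnion bag) : {i | i ∈ M ∧ x ∈ bag i} = ∅ :=
      Set.eq_empty_of_forall_notMem fun i hi => h (mem_biUnion.2 ⟨i, hi⟩)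
    rw [hnodes]
    by_cases hxP : x ∈ P.biUnion bag
    · by_cases hxQ : x ∈ Q.biUnion bag
      · obtain ⟨hxr, hxs⟩ := mem_inter.1 (hcross (mem_inter.2 ⟨hxP, hxQ⟩))
        exact SimpleGraph.connected_induce_union (hP.connected_nodes x hxP).preconnected
          (hQ.connected_nodes x hxQ).preconnected ⟨hr, hxr⟩ ⟨hs, hxs⟩ hrs
      · rw [hempty hxQ, Set.union_empty]
        exact hP.connected_nodes x hxP
    · rw [hempty hxP, Set.empty_union]
      exact hQ.connected_nodes x (by grind)
  exists_mem_of_adj x hx y hy hxy := by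
    rw [union_biUnion] at hx hy
    have hside : (x ∈ P.biUnion bag ∧ y ∈ P.biUnion bag) ∨
        x ∈ Q.biUnion bag ∧ y ∈ Q.biUnion bag := by
      have := hn.symm
      generalize P.biUnion bag = U at *
      generalize Q.biUnion bag = W at *
      grind [Anticomplete]
    rcases hside with ⟨hxP, hyP⟩ | ⟨hxQ, hyQ⟩
    · obtain ⟨i, hi, h⟩ := hP.exists_mem_of_adj x hxP y hyP hxy
      exact ⟨i, mem_union_left Q hi, h⟩
    · obtain ⟨i, hi, h⟩ := hQ.exists_mem_of_adj x hxQ y hyQ hxy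
      exact ⟨i, mem_union_right P hi, h⟩

lemma connected_induce_image (f : F →g F') {M : Set ι} (h : (F.induce M).Connected) :
    (F'.induce (f '' M)).Connected :=
  h.map (SimpleGraph.induceHom f (Set.mapsTo_image f M)) (Set.surjective_mapsTo_image_restrict f M)

lemma IsTreeDecomp.image [DecidableEq κ] (h : IsTreeDecomp H F bag N) (f : F →g F')
    (hbag : ∀ i, bag' (f i) = bag i) : IsTreeDecomp H F' bag' (N.image f) := by
  have hU : (N.image f).biUnion bag' = N.biUnion bag := by simp_rw [image_biUnion, hbag]
  refine ⟨?_, fun x hx => ?_, fun x hx y hy hxy => ?_⟩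
  · rw [coe_image]
    exact connected_induce_image f h.connected
  · have hnodes : {j | j ∈ N.image f ∧ x ∈ bag' j} = f '' {i | i ∈ N ∧ x ∈ bag i} := by
      ext j
      grind
    rw [hnodes]
    exact connected_induce_image f (h.connected_nodes x (hU ▸ hx))
  · obtain ⟨i, hi, hxi, hyi⟩ := h.exists_mem_of_adj x (hU ▸ hx) y (hU ▸ hy) hxy
    exact ⟨f i, mem_image_of_mem f hi, by rwa [hbag], by rwa [hbag]⟩

/-- The subgraph of `H` induced by `U` has a tree decomposition with all bags of size at most `b`,
one of which is `X`. -/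
def HasTreeDecomp (H : SimpleGraph α) (b : ℕ) (X U : Finset α) : Prop :=
  ∃ (ι : Type) (_ : Fintype ι) (F : SimpleGraph ι) (bag : ι → Finset α) (r : ι), F.IsTree ∧
    IsTreeDecomp H F bag univ ∧ bag r = X ∧ univ.biUnion bag = U ∧ ∀ i, #(bag i) ≤ b

lemma HasTreeDecomp.single (hX : #X ≤ b) : HasTreeDecomp H b X X := by
  refine ⟨Unit, inferInstance, ⊥, fun _ => X, (), .of_subsingleton, ⟨?_, fun x hx => ?_, ?_⟩,
    rfl, by simp, fun _ => hX⟩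
  · rw [coe_univ]
    exact ⟨.of_subsingleton⟩
  · have : Nonempty {i : Unit | i ∈ univ ∧ x ∈ X} := ⟨⟨(), by simpa using hx⟩⟩
    exact ⟨.of_subsingleton⟩
  · simpa using fun x hx y hy _ => ⟨hx, hy⟩

lemma isTree_sum_sup_edge [Finite ι] [Finite κ] (hF : F.IsTree) (hF' : F'.IsTree) (i : ι) (j : κ) :
    ((F ⊕g F') ⊔ SimpleGraph.edge (Sum.inl i) (Sum.inr j)).IsTree := by
  have := Fintype.ofFinite ι
  have := Fintype.ofFinite κ
  rw [SimpleGraph.isTree_iff_connected_and_card] at *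
  refine ⟨hF.1.sum_sup_edge hF'.1, ?_⟩
  have hcard := SimpleGraph.card_edgeFinset_sup_edge (F ⊕g F')
    (SimpleGraph.not_adj_sum_inl_inr i j) Sum.inl_ne_inr
  have hsum := Nat.card_congr (SimpleGraph.edgeSetSumEquiv (G := F) (H := F'))
  simp only [Fintype.card_sum, SimpleGraph.edgeFinset_card, Nat.card_eq_fintype_card] at *
  omega

lemma HasTreeDecomp.union (hU : HasTreeDecomp H b X U) (hW : HasTreeDecomp H b Y W)
    (hcross : U ∩ W ⊆ X ∩ Y) (hn : Anticomplete H (U \ W) (W \ U)) :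
    HasTreeDecomp H b X (U ∪ W) := by
  obtain ⟨ι, _, F, bag, r, hF, hdec, rfl, rfl, hb⟩ := hU
  obtain ⟨κ, _, F', bag', s, hF', hdec', rfl, rfl, hb'⟩ := hW
  have hleft := hdec.image (F' := (F ⊕g F') ⊔ SimpleGraph.edge (Sum.inl r) (Sum.inr s))
    (bag' := Sum.elim bag bag') ⟨Sum.inl, fun h => by simp [h]⟩ fun i => rfl
  have hright := hdec'.image (F' := (F ⊕g F') ⊔ SimpleGraph.edge (Sum.inl r) (Sum.inr s))
    (bag' := Sum.elim bag bag') ⟨Sum.inr, fun h => by simp [h]⟩ fun i => rfl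
  have huniv : (univ : Finset (ι ⊕ κ)) = univ.image Sum.inl ∪ univ.image Sum.inr := by
    ext (i | j) <;> simp
  refine ⟨ι ⊕ κ, inferInstance, _, Sum.elim bag bag', .inl r, isTree_sum_sup_edge hF hF' r s, ?_,
    rfl, ?_, Sum.forall.2 ⟨hb, hb'⟩⟩
  · rw [huniv]
    refine hleft.union hright (r := .inl r) (s := .inr s) (by simp) (by simp) ?_ ?_ ?_
    · simp [SimpleGraph.edge_adj]
    · simpa [image_biUnion] using hcross
    · simpa [image_biUnion] using hn
  · simp [huniv, union_biUnion, image_biUnion]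

lemma RootedDecomp.hasTreeDecomp (h : RootedDecomp H b X C) : HasTreeDecomp H b X (X ∪ C) := by
  induction h with
  | single X hX => simpa using HasTreeDecomp.single hX
  | union X C₁ C₂ _ _ hd hn ih₁ ih₂ =>
    have := ih₁.union ih₂ (by grind [disjoint_left]) (hn.mono (by grind) (by grind))
    convert this using 1
    grind
  | step X X' C hX _ hd hn ih =>
    have := (HasTreeDecomp.single (H := H) hX).union ih (by grind [disjoint_left])
      (hn.symm.mono (by grind) (by grind))
    convert this using 1
    grind

lemma isTreeDecomp_univ_iff [Fintype ι] : IsTreeDecomp H F bag univ ↔ F.Connected ∧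
    (∀ x ∈ univ.biUnion bag, (F.induce {i | x ∈ bag i}).Connected) ∧
    ∀ x ∈ univ.biUnion bag, ∀ y ∈ univ.biUnion bag, H.Adj x y → ∃ i, x ∈ bag i ∧ y ∈ bag i := by
  have hconn : (F.induce ((univ : Finset ι) : Set ι)).Connected ↔ F.Connected := by
    rw [coe_univ]
    exact (SimpleGraph.induceUnivIso F).connected_iff
  have hnodes (x : α) : {i | i ∈ univ ∧ x ∈ bag i} = {i | x ∈ bag i} := by simp
  exact ⟨fun h => ⟨hconn.1 h.connected, fun x hx => hnodes x ▸ h.connected_nodes x hx,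
      fun x hx y hy hxy => by simpa using h.exists_mem_of_adj x hx y hy hxy⟩,
    fun h => ⟨hconn.2 h.1, fun x hx => hnodes x ▸ h.2.1 x hx,
      fun x hx y hy hxy => by simpa using h.2.2 x hx y hy hxy⟩⟩

lemma HasTreeDecomp.exists_fin (h : HasTreeDecomp H b X U) :
    ∃ (n : ℕ) (F : SimpleGraph (Fin n)) (bag : Fin n → Finset α), F.IsTree ∧
      IsTreeDecomp H F bag univ ∧ univ.biUnion bag = U ∧ ∀ i, #(bag i) ≤ b := by
  obtain ⟨ι, _, F, bag, -, hF, hdec, -, hU, hb⟩ := h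
  let e := Fintype.equivFin ι
  let φ : F.comap e.symm ≃g F := SimpleGraph.Iso.comap e.symm F
  refine ⟨_, F.comap e.symm, bag ∘ e.symm, φ.isTree_iff.2 hF, ?_, ?_, fun j => hb _⟩
  · rw [← image_univ_equiv e]
    exact hdec.image φ.symm.toHom fun i => congrArg bag (e.symm_apply_apply i)
  · ext x
    simp [← hU, e.symm.exists_congr_left]

end TreeDecompositions

section Multigraphs

variable {β : Type v} {G : Graph α β}

/-- The simple graph underlying a multigraph. All elements of the vertex type are vertices of it;
those that are not vertices of the multigraph are isolated. -/
def underlying (G : Graph α β) : SimpleGraph α where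
  Adj x y := x ≠ y ∧ G.Adj x y
  symm := ⟨fun _ _ h => ⟨h.1.symm, h.2.symm⟩⟩
  loopless := ⟨fun _ h => h.1 rfl⟩

lemma isConnected_induce_iff {S : Set α} :
    (G.induce S).IsConnected ↔ ((underlying G).induce S).Connected := by
  have hgraph : (G.induce S).toSimpleGraph = (underlying G).induce S := by
    ext ⟨x, hx⟩ ⟨y, hy⟩
    have hadj : (G.induce S).Adj x y ↔ G.Adj x y :=
      exists_congr fun e => by simpa using fun _ => ⟨hx, hy⟩
    exact and_congr (not_congr Subtype.mk_eq_mk) hadj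
  rw [Graph.IsConnected, hgraph]
  rfl

lemma isTwoConnected_induce_iff {S : Set α} :
    (G.induce S).IsTwoConnected ↔ TwoConnected (underlying G) S := by
  have hdelete (x : α) : ((G.induce S).deleteVerts {x}).IsConnected ↔
      ((underlying G).induce (S \ {x})).Connected := by
    have hgraph : (G.induce S).deleteVerts {x} = G.induce (S \ {x}) := by
      refine Graph.ext rfl fun e y z => ?_
      simp only [Graph.deleteVerts_isLink, Graph.induce_isLink, Set.mem_sdiff]
      tauto
    rw [hgraph, isConnected_induce_iff]
  exact ⟨fun h => ⟨h.two_vertices, isConnected_induce_iff.1 h.connected,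
      fun x hx => (hdelete x).1 (h.no_separator x hx)⟩,
    fun h => ⟨isConnected_induce_iff.2 h.connected, h.nontrivial,
      fun x hx => (hdelete x).2 (h.connected_sdiff x hx)⟩⟩

lemma card_filter_adj_le_maxDeg (hV : G.vertexSet.Finite) (hE : G.edgeSet.Finite) {x : α}
    (hx : x ∈ G.vertexSet) : #{y ∈ V | (underlying G).Adj x y} ≤ G.maxDeg := by
  have hadj : ∀ y : {y ∈ V | (underlying G).Adj x y}, ∃ e, G.IsLink e x y :=
    fun y => (mem_filter.1 y.2).2.2
  choose f hf using hadj
  have hinj : Function.Injective f := fun y z hyz =>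
    Subtype.ext ((hf y).right_unique (hyz ▸ hf z))
  calc #{y ∈ V | (underlying G).Adj x y}
      = (Set.range f).ncard := by
        rw [← Set.image_univ, Set.ncard_image_of_injective _ hinj, Set.ncard_univ,
          Nat.card_eq_fintype_card, Fintype.card_coe]
    _ ≤ G.deg x := Set.ncard_le_ncard (Set.range_subset_iff.2 fun y => (hf y).inc_left)
        (hE.subset (G.incidenceSet_subset_edgeSet x))
    _ ≤ G.maxDeg := le_csSup (hV.image _).bddAbove (Set.mem_image_of_mem _ hx)

lemma treewidthLT_of_treeDecomposition {ι : Type} [Finite ι]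
    (D : (G.induce (S : Set α)).TreeDecomposition ι) (hD : ∀ i, #(D.bag i) ≤ t) :
    TreewidthLT (underlying G) t S := by
  have := Fintype.ofFinite ι
  have hS : univ.biUnion D.bag = S := by
    ext x
    simp only [mem_biUnion, mem_univ, true_and]
    exact ⟨fun ⟨i, hi⟩ => D.bag_subset i hi, D.vertex_mem x⟩
  have hdec : IsTreeDecomp (underlying G) D.tree D.bag univ := by
    refine isTreeDecomp_univ_iff.2 ⟨D.isTree.1, ?_, ?_⟩
    · rw [hS]
      exact D.connected
    · rw [hS]
      exact fun x hx y hy ⟨_, e, he⟩ => D.edge_mem e x y (by simpa using ⟨he, hx, hy⟩)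
  obtain ⟨r⟩ := D.isTree.1.nonempty
  have h := (hdec.rootedDecomp D.isTree.2 (fun i _ => hD i) (mem_univ r)).treewidthLT
  rwa [hS, union_sdiff_of_subset (D.bag_subset r)] at h

lemma TreewidthLT.exists_treeDecomposition (h : TreewidthLT (underlying G) t S) :
    ∃ (n : ℕ) (D : (G.induce (S : Set α)).TreeDecomposition (Fin n)), ∀ i, #(D.bag i) ≤ t := by
  have h' := h.hasTreeDecomp
  rw [empty_union] at h'
  obtain ⟨n, F, bag, hF, hdec, rfl, hb⟩ := h'.exists_fin
  obtain ⟨-, hnodes, hadj⟩ := isTreeDecomp_univ_iff.1 hdec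
  have hmem (x : α) (hx : x ∈ univ.biUnion bag) : ∃ i, x ∈ bag i := by simpa using hx
  refine ⟨n, ⟨F, hF, bag, fun i => ?_, hmem, fun e x y hxy => ?_, hnodes⟩, hb⟩
  · exact coe_subset.2 (subset_biUnion_of_mem bag (mem_univ i))
  · obtain ⟨he, hx, hy⟩ : G.IsLink e x y ∧ x ∈ univ.biUnion bag ∧ y ∈ univ.biUnion bag := by
      simpa using hxy
    by_cases hne : x = y
    · simpa [← hne] using hmem x hx
    · exact hadj x hx y hy ⟨hne, e, he⟩

lemma treewidth_induce_lt_iff (ht : 0 < t) :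
    (G.induce (S : Set α)).treewidth < t ↔ TreewidthLT (underlying G) t S := by
  constructor
  · intro h
    obtain ⟨n, D, -⟩ :=
      (TreewidthLT.of_card_le (H := underlying G) (le_refl #S)).exists_treeDecomposition
    obtain ⟨n, D, hD⟩ : (G.induce (S : Set α)).treewidth ∈
        {k | ∃ (n : ℕ) (D : (G.induce (S : Set α)).TreeDecomposition (Fin n)), D.width = k} :=
      Nat.sInf_mem ⟨_, n, D, rfl⟩
    refine treewidthLT_of_treeDecomposition D fun i => ?_
    have hi := le_sup (f := fun i => #(D.bag i)) (mem_univ i)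
    rw [Graph.TreeDecomposition.width] at hD
    omega
  · intro h
    obtain ⟨n, D, hD⟩ := h.exists_treeDecomposition
    have hwidth : D.width ≤ t - 1 := Nat.sub_le_sub_right (Finset.sup_le fun i _ => hD i) 1
    have htreewidth : (G.induce (S : Set α)).treewidth ≤ D.width := Nat.sInf_le ⟨n, D, rfl⟩
    omega

end Multigraphs

section Partition

lemma exists_disjoint_not_treewidthLT {Δ : ℕ} (hΔ : 1 ≤ Δ) (ht : 1 ≤ t)
    (hdeg : ∀ x ∈ V, #{y ∈ V | H.Adj x y} ≤ Δ) (hV : ¬ TreewidthLT H (2 ^ 23 * Δ * t) V) :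
    ∃ A ⊆ V, ∃ B ⊆ V, Disjoint A B ∧ (H.induce (A : Set α)).Connected ∧
      TwoConnected H (B : Set α) ∧ ¬ TreewidthLT H t A ∧ ¬ TreewidthLT H t B := by
  obtain ⟨A, hAV, B, hBV, hAB, hA, hB⟩ : ∃ A ⊆ V, ∃ B ⊆ V, Disjoint A B ∧
      ¬ TreewidthLT H t A ∧ ¬ TreewidthLT H t B := by
    have := mt (treewidthLT_of_forall_disjoint hΔ ht hdeg) hV
    push Not at this
    exact this
  obtain ⟨A', hA'A, hA'⟩ := exists_minimal_le_of_wellFoundedLT (¬ TreewidthLT H t ·) A hA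
  obtain ⟨B', hB'B, hB'⟩ := exists_minimal_le_of_wellFoundedLT (¬ TreewidthLT H t ·) B hB
  exact ⟨A', hA'A.trans hAV, B', hB'B.trans hBV, hAB.mono hA'A hB'B,
    connected_induce_of_minimal_not_treewidthLT hA', twoConnected_of_minimal_not_treewidthLT ht hB',
    hA'.prop, hB'.prop⟩

lemma TwoConnected.one_le_of_degree_le {Δ : ℕ} (hV : TwoConnected H (V : Set α))
    (hdeg : ∀ x ∈ V, #{y ∈ V | H.Adj x y} ≤ Δ) : 1 ≤ Δ := by
  have := Set.nontrivial_coe_sort.2 hV.nontrivial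
  obtain ⟨x, hx⟩ := hV.nontrivial.nonempty
  obtain ⟨⟨y, hy⟩, hxy⟩ := hV.connected.preconnected.exists_adj_of_nontrivial ⟨x, hx⟩
  have hne : {y ∈ V | H.Adj x y}.Nonempty :=
    ⟨y, mem_filter.2 ⟨hy, SimpleGraph.induce_adj.1 hxy⟩⟩
  exact hne.card_pos.trans_le (hdeg x hx)

theorem TwoConnected.exists_partition_not_treewidthLT {Δ : ℕ} (hV : TwoConnected H (V : Set α))
    (hcard : 3 ≤ #V) (hdeg : ∀ x ∈ V, #{y ∈ V | H.Adj x y} ≤ Δ)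
    (h : 0 < t → ¬ TreewidthLT H (2 ^ 23 * Δ * t) V) :
    ∃ A B : Finset α, A ∪ B = V ∧ Disjoint A B ∧ (H.induce (A : Set α)).Connected ∧
      TwoConnected H (B : Set α) ∧ (0 < t → ¬ TreewidthLT H t A ∧ ¬ TreewidthLT H t B) := by
  obtain ⟨A, hAV, B, hBV, hAB, hA, hB, hlarge⟩ : ∃ A ⊆ V, ∃ B ⊆ V, Disjoint A B ∧
      (H.induce (A : Set α)).Connected ∧ TwoConnected H (B : Set α) ∧
      (0 < t → ¬ TreewidthLT H t A ∧ ¬ TreewidthLT H t B) := by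
    rcases t.eq_zero_or_pos with rfl | ht
    · obtain ⟨A, hAV, B, hBV, hAB, hA, hB⟩ :=
        hV.exists_singleton_pair (by rwa [Set.ncard_coe_finset])
      lift A to Finset α using V.finite_toSet.subset hAV
      lift B to Finset α using V.finite_toSet.subset hBV
      exact ⟨A, mod_cast hAV, B, mod_cast hBV, mod_cast hAB, hA, hB, by simp⟩
    · obtain ⟨A, hAV, B, hBV, hAB, hA, hB, hlarge⟩ :=
        exists_disjoint_not_treewidthLT (hV.one_le_of_degree_le hdeg) ht hdeg (h ht)
      exact ⟨A, hAV, B, hBV, hAB, hA, hB, fun _ => hlarge⟩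
  obtain ⟨A', B', hAA', hBB', hunion, hdisj, hA', hB'⟩ := hV.exists_partition hA hB
    (coe_subset.2 hAV) (coe_subset.2 hBV) (disjoint_coe.2 hAB)
  lift A' to Finset α using V.finite_toSet.subset (hunion ▸ Set.subset_union_left)
  lift B' to Finset α using V.finite_toSet.subset (hunion ▸ Set.subset_union_right)
  exact ⟨A', B', mod_cast hunion, mod_cast hdisj, hA', hB', fun ht =>
    ⟨fun hs => (hlarge ht).1 (hs.subset (mod_cast hAA')),
      fun hs => (hlarge ht).2 (hs.subset (mod_cast hBB'))⟩⟩

theorem exists_partition_le_treewidth {β : Type v} {G : Graph α β} (hV : G.vertexSet.Finite)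
    (hE : G.edgeSet.Finite) (hcard : 3 ≤ G.vertexSet.ncard) (hG : G.IsTwoConnected)
    (ht : 2 ^ 23 * G.maxDeg * t ≤ G.treewidth) :
    ∃ A B : Set α, A ∪ B = G.vertexSet ∧ Disjoint A B ∧ (G.induce A).IsConnected ∧
      (G.induce B).IsTwoConnected ∧ t ≤ (G.induce A).treewidth ∧ t ≤ (G.induce B).treewidth := by
  obtain ⟨V, hVG⟩ := hV.exists_finset_coe
  have hGV : G.induce (V : Set α) = G := by rw [hVG, Graph.induce_vertexSet]
  have hV2 : TwoConnected (underlying G) (V : Set α) := by rwa [← isTwoConnected_induce_iff, hGV]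
  have hdeg : ∀ x ∈ V, #{y ∈ V | (underlying G).Adj x y} ≤ G.maxDeg :=
    fun x hx => card_filter_adj_le_maxDeg hV hE (hVG ▸ mem_coe.2 hx)
  have hlarge (hpos : 0 < t) : ¬ TreewidthLT (underlying G) (2 ^ 23 * G.maxDeg * t) V := by
    have hΔ := hV2.one_le_of_degree_le hdeg
    rwa [← treewidth_induce_lt_iff (by positivity), hGV, not_lt]
  obtain ⟨A, B, hunion, hdisj, hA, hB, hAB⟩ := hV2.exists_partition_not_treewidthLT
    (by rwa [← Set.ncard_coe_finset, hVG]) hdeg hlarge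
  refine ⟨A, B, by rw [← coe_union, hunion, hVG], disjoint_coe.2 hdisj,
    isConnected_induce_iff.2 hA, isTwoConnected_induce_iff.2 hB, ?_⟩
  rcases t.eq_zero_or_pos with rfl | hpos
  · exact ⟨Nat.zero_le _, Nat.zero_le _⟩
  · simpa only [← treewidth_induce_lt_iff hpos, not_lt] using hAB hpos

end Partition

end TreewidthPartition

open TreewidthPartition in
theorem lemma4_general :
    ∃ c : ℝ, 0 < c ∧
      ∀ (α : Type u) (β : Type v) (G : Graph α β),
        G.vertexSet.Finite → G.edgeSet.Finite →
        3 ≤ G.vertexSet.ncard → G.IsTwoConnected →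
        ∃ A B : Set α, A ∪ B = G.vertexSet ∧ Disjoint A B ∧
          (G.induce A).IsConnected ∧ (G.induce B).IsTwoConnected ∧
          ⌊c * (G.treewidth : ℝ) / (G.maxDeg : ℝ)⌋₊ ≤
            min (G.induce A).treewidth (G.induce B).treewidth := by
  refine ⟨1 / 2 ^ 23, by positivity, fun α β G hV hE hcard hG => ?_⟩
  have hfloor : 2 ^ 23 * G.maxDeg * ⌊1 / 2 ^ 23 * (G.treewidth : ℝ) / (G.maxDeg : ℝ)⌋₊ ≤
      G.treewidth := by
    rw [one_div_mul_eq_div, div_div]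
    norm_cast
    rw [Nat.floor_div_eq_div]
    exact Nat.mul_div_le _ _
  obtain ⟨A, B, hunion, hdisj, hA, hB, htA, htB⟩ :=
    exists_partition_le_treewidth hV hE hcard hG hfloor
  exact ⟨A, B, hunion, hdisj, hA, hB, le_min htA htB⟩

theorem lemma4 :
    ∃ c : ℝ, 0 < c ∧
      ∀ (α : Type u) (β : Type v) (G : Graph α β),
        G.vertexSet.Finite → G.edgeSet.Finite → G.Loopless →
        3 ≤ G.vertexSet.ncard → G.IsTwoConnected →
        ∃ A B : Set α, A ∪ B = G.vertexSet ∧ Disjoint A B ∧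
          (G.induce A).IsConnected ∧ (G.induce B).IsTwoConnected ∧
          ⌊c * (G.treewidth : ℝ) / (G.maxDeg : ℝ) ^ 2⌋₊ ≤
            min (G.induce A).treewidth (G.induce B).treewidth := by
  obtain ⟨c, hc, h⟩ := lemma4_general
  refine ⟨c, hc, fun α β G hV hE _ hcard hG => ?_⟩
  obtain ⟨A, B, hunion, hdisj, hA, hB, htw⟩ := h α β G hV hE hcard hG
  refine ⟨A, B, hunion, hdisj, hA, hB, le_trans (Nat.floor_mono ?_) htw⟩
  rcases Nat.eq_zero_or_pos G.maxDeg with hΔ | hΔ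
  · simp [hΔ]
  · gcongr
    exact le_self_pow₀ (mod_cast hΔ) two_ne_zero
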